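/- Let $\lambda$ be surface area measure on the unit sphere $\mathbb S^2\subset\mathbb R^3$, let $B(\mathbf y,r)=\{\mathbf x\in\mathbb S^2: d(\mathbf x,\mathbf y)\le r\}$ be the geodesic balls, and let $\mathbf o=(0,0,1)^T$. Let $\mathcal M$ be a Polish space with a $\sigma$-finite Borel measure $\nu$, and let $X$ be a marked point process on $\mathbb S^2$ with marks in $\mathcal M$ whose ground process is locally finite (so $X$ is a random finite subset of $\mathbb S^2\times\mathcal M$) and simple. Suppose that $X$ has intensity functions of all orders $\rho^{(n)}:(\mathbb S^2\times\mathcal M)^n\to[0,\infty)$, $n\ge1$: measurable functions such that for all measurable $B\subset(\mathbb S^2\times\mathcal M)^n$ the expected number of $n$-tuples of pairwise distinct points of $X$ lying in $B$ is $\int_B\rho^{(n)}\,d(\lambda\otimes\nu)^n$. Write $\rho=\rho^{(1)}$ and $\bar\rho_A=\inf_{\mathbf x\in\mathbb S^2,\,m\in A}\rho(\mathbf x,m)$. The correlation functions $\xi_n$ are given by $\xi_1=1$ and, for $n\ge2$, $$\sum_{\pi}\prod_{I\in\pi}\xi_{|I|}\big((z_i)_{i\in I}\big)=\frac{\rho^{(n)}(z_1,\dots,z_n)}{\rho(z_1)\cdots\rho(z_n)},$$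 the sum being over all partitions $\pi$ of $\{1,\dots,n\}$ into non-empty blocks (with the points of each block listed in increasing order of their indices). Suppose that $X$ is intensity-reweighted moment isotropic (IRWMI): $\bar\rho_{\mathcal M}>0$, and $\xi_n\{(\mathbf x_1,m_1),\dots,(\mathbf x_n,m_n)\}=\xi_n\{(O\mathbf x_1,m_1),\dots,(O\mathbf x_n,m_n)\}$ for all $n\ge1$, all $(\mathbf x_i,m_i)\in\mathbb S^2\times\mathcal M$ and all rotations $O\in SO(3)$. Let $P^!_{(\mathbf y,m)}$ be any version of the reduced Palm distributions of $X$, i.e. a probability kernel with $\mathbb E\sum_{z\in X}\mathbf 1\{z\in A,\ X\setminus\{z\}\in N\}=\int_A P^!_z(N)\,\mu(dz)$ for all measurable $A$, $N$, where $\mu$ is the intensity measure of $X$; let $\mathbb E^!_{(\mathbf y,m)}$ be its expectation. Let $C,E\subset\mathcal M$ be disjoint measurable sets with $0<\nu(C)<\infty$ and $\nu(E)>0$, and put $u^r_{\mathbf y,E}(\mathbf x,m)=\bar\rho_E\,\mathbf 1\{\mathbf x\in B(\mathbf y,r),\,m\in E\}/\rho(\mathbf x,m)$. For $\mathbf y\in\mathbb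 S^2$ define $$F^E_{\mathrm{inhom}}(r)=1-\mathbb E\prod_{z\in X}\{1-u^r_{\mathbf y,E}(z)\},\qquad D^{CE}_{\mathrm{inhom}}(r)=1-\frac1{\nu(C)}\int_C\mathbb E^!_{(\mathbf y,m)}\Big[\prod_{z\in X}\{1-u^r_{\mathbf y,E}(z)\}\Big]\nu(dm),$$ $$J^{CE}_{\mathrm{inhom}}(r)=\frac1{\nu(C)}\Big\{\nu(C)+\sum_{n=1}^\infty\frac{(-\bar\rho_E)^n}{n!}J^{CE}_n(r)\Big\},$$ $$J_n^{CE}(r)=\int_C\int_{(B(\mathbf o,r)\times E)^n}\xi_{n+1}\{(\mathbf y,m),(O_{\mathbf y}\mathbf x_1,m_1),\dots,(O_{\mathbf y}\mathbf x_n,m_n)\}\prod_{i=1}^n\lambda(d\mathbf x_i)\,\nu(dm_i)\ \nu(dm),$$ where $O_{\mathbf y}$ is a rotation with $O_{\mathbf y}\mathbf o=\mathbf y$. Let $R\in[0,\pi]$ and assume that $$\limsup_{n\to\infty}\Big(\frac{\bar\rho_E^{\,n}}{n!}\int_{(B(\mathbf o,R)\times E)^n}\frac{\rho^{(n)}(z_1,\dots,z_n)}{\rho(z_1)\cdots\rho(z_n)}\prod_{i=1}^n(\lambda\otimes\nu)(dz_i)\Big)^{1/n}<1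 .$$ If $X_C=X\cap(\mathbb S^2\times C)$ and $X_E=X\cap(\mathbb S^2\times E)$ are independent, then: 1. For $\lambda$-almost every $\mathbf y$, $D^{CE}_{\mathrm{inhom}}(r)$ computed at $\mathbf y$ equals $F^E_{\mathrm{inhom}}(r)$ computed at any point $\mathbf y'\in\mathbb S^2$, for all $r\in[0,R]$. In particular $F^E_{\mathrm{inhom}}$ does not depend on the point, and $D^{CE}_{\mathrm{inhom}}(r)=F^E_{\mathrm{inhom}}(r)$. 2. For every $\mathbf y\in\mathbb S^2$, every rotation $O_{\mathbf y}$ with $O_{\mathbf y}\mathbf o=\mathbf y$ and every $r\in[0,R]$, the integrals and the series defining $J^{CE}_{\mathrm{inhom}}(r)$ converge absolutely and $J^{CE}_{\mathrm{inhom}}(r)=1$. -/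

import Mathlib

open MeasureTheory ProbabilityTheory Filter
open scoped NNReal ENNReal Nat

noncomputable section

namespace SphereMPP

/-! ### The unit sphere -/

abbrev E3 : Type := EuclideanSpace ℝ (Fin 3)

/-- The unit sphere of `ℝ³`. -/
abbrev S2 : Type := Metric.sphere (0 : E3) 1

/-- Surface area measure on the unit sphere (total mass `4π`). -/
def area : Measure S2 := (volume : Measure E3).toSphere

instance : IsFiniteMeasure area := by unfold area; infer_instance

/-- Closed ball for the great-circle (geodesic) distance. -/
def geoBall (y : S2) (r : ℝ) : Set S2 :=
  {x | InnerProductGeometry.angle (y : E3) (x : E3) ≤ r}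

/-- The north pole `o = (0,0,1)`. -/
def northPole : S2 := ⟨!₂[0, 0, 1], by simp [EuclideanSpace.norm_eq, Fin.sum_univ_three]⟩

/-- Rotations of `ℝ³`: linear isometries of determinant one. -/
def Rotation : Type :=
  {O : E3 ≃ₗᵢ[ℝ] E3 // LinearMap.det (O.toLinearEquiv : E3 →ₗ[ℝ] E3) = 1}

/-- The action of a rotation on the sphere. -/
def Rotation.act (O : Rotation) (x : S2) : S2 := ⟨O.1 (x : E3), by simp⟩

variable {M : Type*}

/-- A rotation moves the location of a marked point and keeps its mark. -/
def Rotation.actMarked (O : Rotation) (z : S2 × M) : S2 × M := (O.act z.1, z.2)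

/-! ### Configurations and marked point processes -/

/-- Configurations of marked points. The ground process is locally finite and the sphere is
compact, so a configuration is a finite set of marked points. -/
@[ext] structure Config (M : Type*) where
  points : Finset (S2 × M)

namespace Config

open Classical in
/-- The number of points of a configuration in a set `A`. -/
def count (c : Config M) (A : Set (S2 × M)) : ℕ := (c.points.filter (· ∈ A)).card

open Classical in
/-- `c` with the point `z` removed. -/
def erase (c : Config M) (z : S2 × M) : Config M := ⟨c.points.erase z⟩

open Classical in
/-- The points of `c` with mark in `C`. -/
def restrictMarks (c : Config M) (C : Set M) : Config M := ⟨c.points.filter (·.2 ∈ C)⟩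

/-- The σ-algebra generated by the counts in measurable sets. -/
instance [MeasurableSpace M] : MeasurableSpace (Config M) :=
  ⨆ A : {A : Set (S2 × M) // MeasurableSet A},
    MeasurableSpace.comap (fun c : Config M => c.count A.1) ⊤

open Classical in
/-- The `n`-tuples of pairwise distinct points of `c`. -/
def distinctTuples (c : Config M) (n : ℕ) : Finset (Fin n → S2 × M) :=
  (Fintype.piFinset fun _ => c.points).filter Function.Injective

end Config

/-- A marked point process on the sphere with marks in `M`: a random element of the space of
configurations whose ground process is simple (no two points share a location). -/
structure IsMarkedPointProcess [MeasurableSpace M] {Ω : Type*} [MeasurableSpace Ω]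
    (Pr : Measure Ω) (X : Ω → Config M) : Prop where
  measurable : Measurable X
  simple_ground : ∀ᵐ ω ∂Pr, Set.InjOn Prod.fst ((X ω).points : Set (S2 × M))

section Moments

variable [MeasurableSpace M] {Ω : Type*} [MeasurableSpace Ω]

/-- The `n`-fold product of the reference measure "surface area times `ν`" on `S2 × M`. -/
def refMeasurePow (ν : Measure M) [SigmaFinite ν] (n : ℕ) : Measure (Fin n → S2 × M) :=
  Measure.pi fun _ => area.prod ν

/-- The `n`-th order factorial moment measure `α⁽ⁿ⁾(B)`: the expected number of `n`-tuples of
pairwise distinct points of `X` that lie in `B`. -/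
def factorialMoment (Pr : Measure Ω) (X : Ω → Config M) (n : ℕ) (B : Set (Fin n → S2 × M)) :
    ℝ≥0∞ :=
  ∫⁻ ω, ∑ z ∈ (X ω).distinctTuples n, B.indicator 1 z ∂Pr

/-- The family `ρ n = ρ⁽ⁿ⁾`, `n ≥ 1`, consists of intensity functions of `X` of all orders:
`ρ⁽ⁿ⁾` is a density of `α⁽ⁿ⁾` with respect to the `n`-fold reference measure. (The entry
`ρ 0` is unused.) -/
def AreIntensityFunctions (Pr : Measure Ω) (X : Ω → Config M) (ν : Measure M) [SigmaFinite ν]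
    (ρ : (n : ℕ) → (Fin n → S2 × M) → ℝ≥0) : Prop :=
  ∀ n, 1 ≤ n → Measurable (ρ n) ∧ ∀ B : Set (Fin n → S2 × M), MeasurableSet B →
    factorialMoment Pr X n B = ∫⁻ z in B, (ρ n z : ℝ≥0∞) ∂(refMeasurePow ν n)

/-- The intensity measure `μ(A) = 𝔼 #(X ∩ A)`. -/
def intensityMeasure (Pr : Measure Ω) (X : Ω → Config M) : Measure (S2 × M) :=
  Pr.bind fun ω => ∑ z ∈ (X ω).points, Measure.dirac z

theorem Config.measurable_count {A : Set (S2 × M)} (hA : MeasurableSet A) :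
    Measurable (fun c : Config M => c.count A) :=
  Measurable.mono (comap_measurable _)
    (le_iSup (fun A : {A : Set (S2 × M) // MeasurableSet A} =>
      MeasurableSpace.comap (fun c : Config M => c.count A.1) ⊤) ⟨A, hA⟩) le_rfl

theorem Config.sum_dirac_apply (c : Config M) {A : Set (S2 × M)} (hA : MeasurableSet A) :
    (∑ z ∈ c.points, Measure.dirac z) A = (c.count A : ℝ≥0∞) := by
  classical
  simp only [Measure.finsetSum_apply, Measure.dirac_apply' _ hA, Config.count]
  rw [Finset.card_filter]
  push_cast
  exact Finset.sum_congr rfl fun z _ => by by_cases h : z ∈ A <;> simp [h]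

/-- The defining property of the intensity measure. -/
theorem intensityMeasure_apply {Pr : Measure Ω} {X : Ω → Config M} (hX : Measurable X)
    {A : Set (S2 × M)} (hA : MeasurableSet A) :
    intensityMeasure Pr X A = ∫⁻ ω, ((X ω).count A : ℝ≥0∞) ∂Pr := by
  have hm : Measurable fun ω => ∑ z ∈ (X ω).points, Measure.dirac z := by
    refine Measure.measurable_of_measurable_coe _ fun s hs => ?_
    simp only [Config.sum_dirac_apply _ hs]
    exact (measurable_from_top (f := fun k : ℕ => (k : ℝ≥0∞))).comp
      ((Config.measurable_count hs).comp hX)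
  rw [intensityMeasure, Measure.bind_apply hA hm.aemeasurable]
  simp only [Config.sum_dirac_apply _ hA]

/-- The reduced Campbell measure of the rectangle `A × N`. -/
def reducedCampbell (Pr : Measure Ω) (X : Ω → Config M) (A : Set (S2 × M)) (N : Set (Config M)) :
    ℝ≥0∞ :=
  ∫⁻ ω, ∑ z ∈ (X ω).points, (A ×ˢ N).indicator 1 (z, (X ω).erase z) ∂Pr

/-- `P z` is (a version of) the reduced Palm distribution of `X` at the marked point `z`: a
probability kernel which disintegrates the reduced Campbell measure with respect to the
intensity measure. -/
def IsReducedPalm (Pr : Measure Ω) (X : Ω → Config M) (P : Kernel (S2 × M) (Config M)) : Prop :=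
  IsMarkovKernel P ∧ ∀ (A : Set (S2 × M)) (N : Set (Config M)), MeasurableSet A →
    MeasurableSet N → reducedCampbell Pr X A N = ∫⁻ z in A, P z N ∂(intensityMeasure Pr X)

end Moments

/-! ### Correlation functions and IRWMI processes -/

/-- The intensity function `ρ = ρ⁽¹⁾` as a function of one marked point. -/
def intensity (ρ : (n : ℕ) → (Fin n → S2 × M) → ℝ≥0) (z : S2 × M) : ℝ≥0 := ρ 1 fun _ => z

/-- `ρ⁽ⁿ⁾(z₁,…,zₙ) / (ρ(z₁)⋯ρ(zₙ))`. -/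
def reweighted (ρ : (n : ℕ) → (Fin n → S2 × M) → ℝ≥0) (n : ℕ) (z : Fin n → S2 × M) : ℝ≥0 :=
  ρ n z / ∏ i, intensity ρ (z i)

theorem card_lt_of_mem_parts {n : ℕ} (Q : Finpartition (Finset.univ : Finset (Fin n)))
    (hQ : 1 < Q.parts.card) {B : Finset (Fin n)} (hB : B ∈ Q.parts) : B.card < n := by
  obtain ⟨B', hB', hne⟩ := Finset.exists_mem_ne hQ B
  have hd : Disjoint B' B := Q.disjoint hB' hB hne
  obtain ⟨i, hi⟩ := Q.nonempty_of_mem_parts hB'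
  have hlt : B ⊂ Finset.univ := by
    refine (Finset.ssubset_univ_iff).2 fun h => ?_
    exact Finset.disjoint_left.1 hd hi (h ▸ Finset.mem_univ i)
  simpa using Finset.card_lt_card hlt

/-- The correlation functions `ξₙ`. For `n ≥ 2` they are determined recursively by requiring
that the sum over all partitions `Q` of `{1,…,n}` of `∏_{B ∈ Q} ξ_{|B|}(z_i : i ∈ B)` equals
`ρ⁽ⁿ⁾(z₁,…,zₙ) / (ρ(z₁)⋯ρ(zₙ))` (see `sum_partitions_correlation`), and `ξ₁ = 1`. -/
def correlation (ρ : (n : ℕ) → (Fin n → S2 × M) → ℝ≥0) :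
    (n : ℕ) → (Fin n → S2 × M) → ℝ
  | 1, _ => 1
  | n, z =>
    (reweighted ρ n z : ℝ) -
      ∑ Q : Finpartition (Finset.univ : Finset (Fin n)),
        if h : 1 < Q.parts.card then
          ∏ B : {B // B ∈ Q.parts},
            have : B.1.card < n := card_lt_of_mem_parts Q h B.2
            correlation ρ B.1.card (z ∘ B.1.orderEmbOfFin rfl)
        else 0
  termination_by n => n

/-- The defining identity of the correlation functions. -/
theorem sum_partitions_correlation (ρ : (n : ℕ) → (Fin n → S2 × M) → ℝ≥0) (n : ℕ)
    (hn : 2 ≤ n) (z : Fin n → S2 × M) :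
    ∑ Q : Finpartition (Finset.univ : Finset (Fin n)),
      ∏ B ∈ Q.parts, correlation ρ B.card (z ∘ B.orderEmbOfFin rfl) = reweighted ρ n z := by
  obtain ⟨k, rfl⟩ : ∃ k, n = k + 2 := ⟨n - 2, by omega⟩
  have hne : (Finset.univ : Finset (Fin (k + 2))) ≠ ⊥ := Finset.univ_nonempty.ne_empty
  have hcast : ∀ (j : ℕ) (h : (Finset.univ : Finset (Fin (k + 2))).card = j),
      correlation ρ _ (z ∘ (Finset.univ : Finset (Fin (k + 2))).orderEmbOfFin rfl) =
        correlation ρ j (z ∘ (Finset.univ : Finset (Fin (k + 2))).orderEmbOfFin h) := by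
    rintro _ rfl; rfl
  have hid : ∀ h : (Finset.univ : Finset (Fin (k + 2))).card = k + 2,
      (z ∘ (Finset.univ : Finset (Fin (k + 2))).orderEmbOfFin h) = z := by
    intro h
    have : (RelEmbedding.refl (· ≤ ·) : Fin (k + 2) ↪o Fin (k + 2)) =
        (Finset.univ : Finset (Fin (k + 2))).orderEmbOfFin h :=
      Finset.orderEmbOfFin_unique' h fun x => Finset.mem_univ _
    rw [← this]; rfl
  have htop : ∀ Q : Finpartition (Finset.univ : Finset (Fin (k + 2))),
      Q ≠ Finpartition.indiscrete hne → 1 < Q.parts.card := by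
    intro Q hQ
    by_contra! hle
    apply hQ
    have hpos : 0 < Q.parts.card := Finset.card_pos.2 (Q.parts_nonempty hne)
    obtain ⟨B, hB⟩ := Finset.card_eq_one.1 (le_antisymm hle hpos)
    have hs := Q.sup_parts
    rw [hB] at hs
    simp only [Finset.sup_singleton, id] at hs
    ext1
    rw [hB, hs]; rfl
  rw [← Finset.add_sum_erase _ _ (Finset.mem_univ (Finpartition.indiscrete hne))]
  have h1 : ∏ B ∈ (Finpartition.indiscrete hne).parts,
      correlation ρ B.card (z ∘ B.orderEmbOfFin rfl) = correlation ρ (k + 2) z := by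
    rw [Finpartition.indiscrete_parts, Finset.prod_singleton, hcast (k + 2) (by simp), hid]
  rw [h1, correlation]
  · rw [← Finset.add_sum_erase (Finset.univ : Finset (Finpartition _)) _
      (Finset.mem_univ (Finpartition.indiscrete hne))]
    rw [dif_neg (by simp)]
    have h2 : ∀ Q ∈ Finset.univ.erase (Finpartition.indiscrete hne),
        (if h : 1 < Q.parts.card then
          ∏ B : {B // B ∈ Q.parts}, correlation ρ B.1.card (z ∘ B.1.orderEmbOfFin rfl)
        else 0) = ∏ B ∈ Q.parts, correlation ρ B.card (z ∘ B.orderEmbOfFin rfl) := by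
      intro Q hQ
      rw [dif_pos (htop Q (Finset.ne_of_mem_erase hQ))]
      exact Finset.prod_coe_sort Q.parts
        fun B => correlation ρ B.card (z ∘ B.orderEmbOfFin rfl)
    rw [Finset.sum_congr rfl h2]
    ring
  · omega

/-- `ρ̄_E`, the infimum of the intensity function over `S2 × E`. -/
def infIntensity (ρ : (n : ℕ) → (Fin n → S2 × M) → ℝ≥0) (E : Set M) : ℝ≥0 :=
  sInf (intensity ρ '' (Set.univ ×ˢ E))

/-- Intensity-reweighted moment isotropy, in terms of the intensity functions `ρ` of all orders:
the intensity is bounded away from zero and the correlation functions are invariant under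
rotations. -/
def IsIRWMI (ρ : (n : ℕ) → (Fin n → S2 × M) → ℝ≥0) : Prop :=
  0 < infIntensity ρ (Set.univ : Set M) ∧
    ∀ n, 1 ≤ n → ∀ (z : Fin n → S2 × M) (O : Rotation),
      correlation ρ n z = correlation ρ n fun i => O.actMarked (z i)

/-! ### Summary functions -/

/-- `u^r_{y,E}(x,m) = ρ̄_E 1{x ∈ B(y,r), m ∈ E} / ρ(x,m)`. -/
def uFun (ρ : (n : ℕ) → (Fin n → S2 × M) → ℝ≥0) (E : Set M) (y : S2) (r : ℝ) (z : S2 × M) : ℝ :=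
  (geoBall y r ×ˢ E).indicator (fun z => (infIntensity ρ E : ℝ) / (intensity ρ z : ℝ)) z

section Summary

variable [MeasurableSpace M]

/-- The generating functional `G(v) = 𝔼 ∏_{z ∈ X} v(z)` of a distribution `Q` of
configurations. -/
def genFun (Q : Measure (Config M)) (v : S2 × M → ℝ) : ℝ := ∫ c, ∏ z ∈ c.points, v z ∂Q

/-- `F^E_inhom(r) = 1 - G(1 - u^r_{y,E})`, computed at the point `y`. -/
def FInhom {Ω : Type*} [MeasurableSpace Ω] (Pr : Measure Ω) (X : Ω → Config M)
    (ρ : (n : ℕ) → (Fin n → S2 × M) → ℝ≥0) (E : Set M) (y : S2) (r : ℝ) : ℝ :=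
  1 - genFun (Pr.map X) (fun z => 1 - uFun ρ E y r z)

/-- `D^{CE}_inhom(r) = 1 - G^!_{y,C}(1 - u^r_{y,E})`, computed at the point `y`, where
`G^!_{y,C}` is the `ν`-average over marks in `C` of the generating functionals of the reduced
Palm distributions `P (y,m)`. -/
def DInhom (P : Kernel (S2 × M) (Config M)) (ν : Measure M)
    (ρ : (n : ℕ) → (Fin n → S2 × M) → ℝ≥0) (C E : Set M) (y : S2) (r : ℝ) : ℝ :=
  1 - (ν.real C)⁻¹ * ∫ m in C, genFun (P (y, m)) (fun z => 1 - uFun ρ E y r z) ∂ν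

/-- The integrand of `J_n^{CE}` at `y`, written in coordinates rotated by `O`. -/
def JIntegrand (ρ : (n : ℕ) → (Fin n → S2 × M) → ℝ≥0) (n : ℕ) (y : S2) (O : Rotation)
    (m : M) (z : Fin n → S2 × M) : ℝ :=
  correlation ρ (n + 1) (Fin.cons (y, m) fun i => O.actMarked (z i))

/-- The domain `(B(o,r) × E)ⁿ`. -/
def capTuples (E : Set M) (r : ℝ) (n : ℕ) : Set (Fin n → S2 × M) :=
  Set.univ.pi fun _ => geoBall northPole r ×ˢ E

/-- `J_n^{CE}(r)` at the point `y`, where `O` is a rotation carrying `o` to `y`. -/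
def Jn (ν : Measure M) [SigmaFinite ν] (ρ : (n : ℕ) → (Fin n → S2 × M) → ℝ≥0) (C E : Set M)
    (n : ℕ) (y : S2) (O : Rotation) (r : ℝ) : ℝ :=
  ∫ m in C, ∫ z in capTuples E r n, JIntegrand ρ n y O m z ∂(refMeasurePow ν n) ∂ν

/-- The `n`-th term of the series defining `J^{CE}_inhom(r)`. -/
def JTerm (ν : Measure M) [SigmaFinite ν] (ρ : (n : ℕ) → (Fin n → S2 × M) → ℝ≥0) (C E : Set M)
    (y : S2) (O : Rotation) (r : ℝ) (n : ℕ) : ℝ :=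
  (-(infIntensity ρ E : ℝ)) ^ n / (n ! : ℝ) * Jn ν ρ C E n y O r

/-- `J^{CE}_inhom(r) = ν(C)⁻¹ (ν(C) + ∑_{n ≥ 1} (-ρ̄_E)ⁿ/n! J_n^{CE}(r))`. -/
def JInhom (ν : Measure M) [SigmaFinite ν] (ρ : (n : ℕ) → (Fin n → S2 × M) → ℝ≥0) (C E : Set M)
    (y : S2) (O : Rotation) (r : ℝ) : ℝ :=
  (ν.real C)⁻¹ * (ν.real C + ∑' n : ℕ, JTerm ν ρ C E y O r (n + 1))

/-- All integrals `J_n^{CE}(r)` and the series in the definition of `J^{CE}_inhom(r)` converge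
absolutely. -/
def JInhomConverges (ν : Measure M) [SigmaFinite ν] (ρ : (n : ℕ) → (Fin n → S2 × M) → ℝ≥0)
    (C E : Set M) (y : S2) (O : Rotation) (r : ℝ) : Prop :=
  (∀ n, 1 ≤ n → Integrable (fun q : M × (Fin n → S2 × M) => JIntegrand ρ n y O q.1 q.2)
    ((ν.restrict C).prod ((refMeasurePow ν n).restrict (capTuples E r n)))) ∧
  Summable fun n : ℕ => JTerm ν ρ C E y O r (n + 1)

/-- The moment condition
`limsup_n ((ρ̄_E)ⁿ/n! ∫_{(B(o,r)×E)ⁿ} ρ⁽ⁿ⁾(z₁,…,zₙ)/(ρ(z₁)⋯ρ(zₙ)))^{1/n} < 1`. -/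
def MomentCondition (ν : Measure M) [SigmaFinite ν] (ρ : (n : ℕ) → (Fin n → S2 × M) → ℝ≥0)
    (E : Set M) (r : ℝ) : Prop :=
  limsup (fun n : ℕ => (((infIntensity ρ E ^ n / (n ! : ℝ≥0) : ℝ≥0) : ℝ≥0∞) *
    ∫⁻ z in capTuples E r n, (reweighted ρ n z : ℝ≥0∞) ∂(refMeasurePow ν n)) ^ (1 / (n : ℝ)))
    atTop < 1

end Summary

end SphereMPP

end

open SphereMPP

/-! Independence of the `C`-part and the `E`-part makes every expectation of a sum over `C`-points
times a functional of the `E`-points factorize. Both claims are consequences.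

For the first claim, removing a `C`-point does not change the `E`-part. The reduced Campbell
measure, restricted to `C`-points and to events about the `E`-part, is therefore the intensity
measure times the law of the `E`-part. So at almost every `C`-point the Palm law of the `E`-part is
its unconditional law (`ae_palm_restrictMarks`). Since `uFun` vanishes off `E`, the Palm and the
ordinary generating functionals agree at `y` (`genFun_palm_eq`). To pass from `y` to an arbitrary
`y'`, the product is expanded into elementary symmetric sums and integrated term by term, which the
moment condition permits (`integral_prod_one_sub`). Each term is an integral of a reweighted
intensity over a cap, and rotation invariance removes the centre of the cap (`genFun_uFun_eq_tsum`).

For the second claim, factorization of the factorial moments gives `ρ (n + 1) (z₀, z) = ρ(z₀) ρ n z`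
for almost all `z₀` with mark in `C` and `z` with marks in `E` (`ae_intensity_succ`). Induction over
partitions then forces the mixed correlation functions to vanish (`correlation_eq_zero`). This is an
almost-everywhere statement in the location of `z₀`, but by Fubini it holds at one location, and
isotropy carries it to all of them (`ae_JIntegrand_eq_zero`). Hence every `Jn` with `n ≥ 1` is zero
and only the leading term of `JInhom` remains. -/

namespace SphereMPP

/-! ### Measurability on the space of configurations, and Campbell's formula for distinct tuples. -/

section Configurations

theorem Config.count_restrictMarks {M : Type*} (c : Config M) (C : Set M) (A : Set (S2 × M)) :
    (c.restrictMarks C).count A = c.count (A ∩ Prod.snd ⁻¹' C) := by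
  classical
  simp only [Config.count, Config.restrictMarks, Finset.filter_filter]
  congr 1
  ext z
  simp [and_comm]

variable {M : Type*} [MeasurableSpace M]

/-- The counting measure of a configuration. -/
noncomputable def Config.toMeasure (c : Config M) : Measure (S2 × M) :=
  ∑ z ∈ c.points, Measure.dirac z

instance (c : Config M) : IsFiniteMeasure c.toMeasure := by
  unfold Config.toMeasure; infer_instance

theorem Config.toMeasure_apply (c : Config M) {A : Set (S2 × M)} (hA : MeasurableSet A) :
    c.toMeasure A = (c.count A : ℝ≥0∞) := c.sum_dirac_apply hA

theorem Config.measurable_count_ennreal {A : Set (S2 × M)} (hA : MeasurableSet A) :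
    Measurable fun c : Config M => (c.count A : ℝ≥0∞) :=
  (measurable_from_top (f := fun k : ℕ => (k : ℝ≥0∞))).comp (Config.measurable_count hA)

theorem Config.measurable_toMeasure : Measurable (Config.toMeasure : Config M → _) :=
  Measure.measurable_of_measurable_coe _ fun s hs => by
    simp only [Config.toMeasure_apply _ hs]
    exact Config.measurable_count_ennreal hs

theorem Config.lintegral_toMeasure (c : Config M) {f : S2 × M → ℝ≥0∞} (hf : Measurable f) :
    ∫⁻ z, f z ∂c.toMeasure = ∑ z ∈ c.points, f z := by
  simp [Config.toMeasure, lintegral_finsetSum_measure, lintegral_dirac' _ hf]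

theorem Config.measurable_sum_points {f : S2 × M → ℝ≥0∞} (hf : Measurable f) :
    Measurable fun c : Config M => ∑ z ∈ c.points, f z := by
  simp only [← Config.lintegral_toMeasure _ hf]
  exact (Measure.measurable_lintegral hf).comp Config.measurable_toMeasure

theorem measurable_to_config {β : Type*} [MeasurableSpace β] {f : β → Config M}
    (hf : ∀ A, MeasurableSet A → Measurable fun b => (f b).count A) : Measurable f := by
  refine Measurable.of_le_map (iSup_le fun A => ?_)
  rintro _ ⟨s, hs, rfl⟩
  exact hf A.1 A.2 hs

theorem Config.measurable_restrictMarks {C : Set M} (hC : MeasurableSet C) :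
    Measurable fun c : Config M => c.restrictMarks C :=
  measurable_to_config fun A hA => by
    simp only [Config.count_restrictMarks]
    exact Config.measurable_count (hA.inter (measurable_snd hC))

/-- A product over points becomes a sum through `exp` and `-log`, and sums over points are integrals
against the counting measure. Configurations that meet the zero set of `v` are split off, because
`Real.log 0 = 0` would give the factor one instead of zero. -/
theorem Config.measurable_prod_points {v : S2 × M → ℝ} (hv : Measurable v)
    (h0 : ∀ z, 0 ≤ v z) (h1 : ∀ z, v z ≤ 1) :
    Measurable fun c : Config M => ∏ z ∈ c.points, v z := by
  have key : ∀ c : Config M, ∏ z ∈ c.points, v z = if c.count {z | v z = 0} = 0 then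
      Real.exp (-(∑ z ∈ c.points, ENNReal.ofReal (-Real.log (v z))).toReal) else 0 := by
    classical
    intro c
    split_ifs with h
    · simp only [Config.count, Finset.card_eq_zero, Finset.filter_eq_empty_iff,
        Set.mem_ofPred_eq] at h
      rw [ENNReal.toReal_sum (by simp), ← Finset.sum_neg_distrib, Real.exp_sum]
      refine Finset.prod_congr rfl fun z hz => ?_
      have hpos : 0 < v z := lt_of_le_of_ne (h0 z) (Ne.symm (h hz))
      rw [ENNReal.toReal_ofReal (by simpa using Real.log_nonpos (h0 z) (h1 z)), neg_neg,
        Real.exp_log hpos]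
    · simp only [Config.count, Finset.card_eq_zero, Finset.filter_eq_empty_iff,
        Set.mem_ofPred_eq, not_forall, not_not] at h
      obtain ⟨z, hz, hz0⟩ := h
      exact Finset.prod_eq_zero hz hz0
  simp only [key]
  refine Measurable.ite ?_ ?_ measurable_const
  · exact Config.measurable_count (hv (measurableSet_singleton 0)) (measurableSet_singleton 0)
  · refine Real.measurable_exp.comp (Measurable.neg ?_)
    exact (Config.measurable_sum_points (by fun_prop)).ennreal_toReal

open Classical in
/-- The counting measure of the `n`-tuples of pairwise distinct points. -/
noncomputable def Config.tupleMeasure (c : Config M) (n : ℕ) : Measure (Fin n → S2 × M) :=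
  ∑ z ∈ c.distinctTuples n, Measure.dirac z

theorem Config.lintegral_tupleMeasure (c : Config M) {n : ℕ} {g : (Fin n → S2 × M) → ℝ≥0∞}
    (hg : Measurable g) :
    ∫⁻ z, g z ∂c.tupleMeasure n = ∑ z ∈ c.distinctTuples n, g z := by
  simp [Config.tupleMeasure, lintegral_finsetSum_measure, lintegral_dirac' _ hg]

theorem measurableSet_injective [MeasurableEq M] (n : ℕ) :
    MeasurableSet {z : Fin n → S2 × M | Function.Injective z} := by
  have : {z : Fin n → S2 × M | Function.Injective z} =
      ⋂ i, ⋂ j, {z | z i = z j → i = j} := by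
    ext z; simp [Function.Injective]
  rw [this]
  refine MeasurableSet.iInter fun i => MeasurableSet.iInter fun j => ?_
  by_cases h : i = j
  · simp [h]
  · have : {z : Fin n → S2 × M | z i = z j → i = j} = {z | z i = z j}ᶜ := by
      ext z; simp [h]
    rw [this]
    have e : {z : Fin n → S2 × M | z i = z j} = {z | (z i).1 = (z j).1} ∩ {z | (z i).2 = (z j).2} := by
      ext z; simp [Prod.ext_iff]
    rw [e]
    exact ((measurableSet_eq_fun (by fun_prop) (by fun_prop)).inter
      (measurableSet_eq_fun (by fun_prop) (by fun_prop))).compl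

/-- Over all tuples, repetitions allowed, the mass of a box is a product of counts, and boxes form a
generating π-system. Distinctness is then a restriction to the measurable set of injective tuples.
-/
theorem Config.measurable_tupleMeasure [MeasurableEq M] (n : ℕ) :
    Measurable fun c : Config M => c.tupleMeasure n := by
  classical
  let κ : Config M → Measure (Fin n → S2 × M) := fun c =>
    ∑ z ∈ Fintype.piFinset fun _ => c.points, Measure.dirac z
  have hbox : ∀ A : Fin n → Set (S2 × M), (∀ i, MeasurableSet (A i)) → ∀ c,
      κ c (Set.univ.pi A) = ∏ i, (c.count (A i) : ℝ≥0∞) := by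
    intro A hA c
    simp only [κ, Measure.finsetSum_apply, Measure.dirac_apply' _ (MeasurableSet.univ_pi hA),
      ← Config.sum_dirac_apply c (hA _), Measure.dirac_apply' _ (hA _)]
    rw [Finset.prod_univ_sum]
    refine Finset.sum_congr rfl fun z _ => ?_
    by_cases h : ∀ i, z i ∈ A i
    · simp [Set.indicator, h]
    · obtain ⟨i, hi⟩ := not_forall.1 h
      rw [Finset.prod_eq_zero (Finset.mem_univ i) (by simp [hi]),
        Set.indicator_of_notMem (by simpa using ⟨i, by simpa using hi⟩)]
  have hfin : ∀ c, IsFiniteMeasure (κ c) := fun c => by dsimp only [κ]; infer_instance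
  have hκ : Measurable κ := by
    refine Measurable.measure_of_isPiSystem generateFrom_pi.symm isPiSystem_pi ?_ ?_
    · rintro _ ⟨A, hA, rfl⟩
      simp only [hbox A fun i => hA i (Set.mem_univ i)]
      exact Finset.measurable_prod _ fun i _ =>
        Config.measurable_count_ennreal (hA i (Set.mem_univ i))
    · have := hbox (fun _ => Set.univ) fun _ => MeasurableSet.univ
      simp only [Set.pi_univ] at this
      simp only [this]
      exact Finset.measurable_prod _ fun i _ => Config.measurable_count_ennreal MeasurableSet.univ
  have hrestr : (fun c : Config M => c.tupleMeasure n) =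
      fun c => (κ c).restrict {z | Function.Injective z} := by
    funext c
    ext s hs
    simp only [Config.tupleMeasure, Config.distinctTuples, κ,
      Measure.restrict_apply hs, Measure.finsetSum_apply,
      Measure.dirac_apply' _ (hs.inter (measurableSet_injective n)),
      Finset.sum_filter]
    refine Finset.sum_congr rfl fun z _ => ?_
    by_cases h : Function.Injective z <;> simp [Set.indicator, h]
  rw [hrestr]
  refine Measure.measurable_of_measurable_coe _ fun s hs => ?_
  simp only [Measure.restrict_apply hs]
  exact (Measure.measurable_coe (hs.inter (measurableSet_injective n))).comp hκ

theorem Config.measurable_sum_distinctTuples [MeasurableEq M] {n : ℕ}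
    {g : (Fin n → S2 × M) → ℝ≥0∞} (hg : Measurable g) :
    Measurable fun c : Config M => ∑ z ∈ c.distinctTuples n, g z := by
  simp only [← Config.lintegral_tupleMeasure _ hg]
  exact (Measure.measurable_lintegral hg).comp (Config.measurable_tupleMeasure n)

/-- The expected tuple measure has density `ρ n`. This extends the definition of intensity functions
from sets to nonnegative measurable functions. -/
theorem lintegral_sum_distinctTuples [MeasurableEq M] {Ω : Type*} [MeasurableSpace Ω]
    {Pr : Measure Ω} {ν : Measure M} [SigmaFinite ν] {X : Ω → Config M} (hX : Measurable X)
    {ρ : (n : ℕ) → (Fin n → S2 × M) → ℝ≥0} (hρ : AreIntensityFunctions Pr X ν ρ)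
    {n : ℕ} (hn : 1 ≤ n) {g : (Fin n → S2 × M) → ℝ≥0∞} (hg : Measurable g) :
    ∫⁻ ω, ∑ z ∈ (X ω).distinctTuples n, g z ∂Pr =
      ∫⁻ z, ρ n z * g z ∂(refMeasurePow ν n) := by
  have hm : Measurable fun ω => (X ω).tupleMeasure n := (Config.measurable_tupleMeasure n).comp hX
  have heq : Pr.bind (fun ω => (X ω).tupleMeasure n) =
      (refMeasurePow ν n).withDensity fun z => (ρ n z : ℝ≥0∞) := by
    ext B hB
    rw [Measure.bind_apply hB hm.aemeasurable, withDensity_apply _ hB, ← (hρ n hn).2 B hB,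
      factorialMoment]
    refine lintegral_congr fun ω => ?_
    simp [Config.tupleMeasure, Measure.dirac_apply' _ hB]
  simp only [← Config.lintegral_tupleMeasure _ hg]
  rw [← Measure.lintegral_bind hm.aemeasurable hg.aemeasurable, heq,
    lintegral_withDensity_eq_lintegral_mul _ ((hρ n hn).1.coe_nnreal_ennreal) hg]
  rfl

theorem exists_countable_isPiSystem (α : Type*) [m : MeasurableSpace α]
    [MeasurableSpace.CountablyGenerated α] :
    ∃ S : Set (Set α), S.Countable ∧ IsPiSystem S ∧ m = MeasurableSpace.generateFrom S ∧
      Set.univ ∈ S := by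
  obtain ⟨b, hb, hm⟩ := MeasurableSpace.CountablyGenerated.isCountablyGenerated (α := α)
  refine ⟨(fun t => ⋂₀ t) '' {t | t.Finite ∧ t ⊆ b}, (Set.countable_ofPred_finite_subset hb).image _,
    ?_, le_antisymm ?_ ?_, ⟨∅, by simp, by simp⟩⟩
  · rintro _ ⟨s, hs, rfl⟩ _ ⟨t, ht, rfl⟩ _
    exact ⟨s ∪ t, ⟨hs.1.union ht.1, Set.union_subset hs.2 ht.2⟩, Set.sInter_union s t⟩
  · rw [hm]
    exact MeasurableSpace.generateFrom_mono fun s hs =>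
      ⟨{s}, ⟨Set.finite_singleton s, by simpa using hs⟩, by simp⟩
  · refine MeasurableSpace.generateFrom_le ?_
    rintro _ ⟨t, ht, rfl⟩
    refine MeasurableSet.sInter ht.1.countable fun s hs => ?_
    rw [hm]
    exact MeasurableSpace.measurableSet_generateFrom (ht.2 hs)

/-- Counts on a countable π-system of `S2 × M` already determine, measurably, the counts on all
measurable sets. Countable generation is what later yields a single null set valid for all events of
configurations. -/
instance [MeasurableSpace.CountablyGenerated M] :
    MeasurableSpace.CountablyGenerated (Config M) := by
  obtain ⟨S, hS, hpi, hgen, huniv⟩ := exists_countable_isPiSystem (S2 × M)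
  have : Countable S := hS
  let counts : Config M → S → ℕ := fun c s => c.count s.1
  have hSm : ∀ s ∈ S, MeasurableSet s := fun s hs => by
    rw [hgen]; exact MeasurableSpace.measurableSet_generateFrom hs
  have hle : (inferInstance : MeasurableSpace (Config M)) =
      MeasurableSpace.comap counts inferInstance := by
    refine le_antisymm (iSup_le fun A => ?_) ?_
    · have h1 : @Measurable _ _ (MeasurableSpace.comap counts inferInstance) _
          (Config.toMeasure : Config M → _) := by
        have hb : ∀ s ∈ S, @Measurable _ _ (MeasurableSpace.comap counts inferInstance) _
            fun c : Config M => c.toMeasure s := by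
          intro s hs
          simp only [Config.toMeasure_apply _ (hSm s hs)]
          exact (measurable_from_top (f := fun k : ℕ => (k : ℝ≥0∞))).comp
            ((measurable_pi_apply (⟨s, hs⟩ : S)).comp (comap_measurable counts))
        exact @Measurable.measure_of_isPiSystem _ _ (MeasurableSpace.comap counts inferInstance) _ _ _
          _ hgen hpi hb (hb _ huniv)
      have h2 : @Measurable _ _ (MeasurableSpace.comap counts inferInstance) ⊤
          fun c : Config M => c.count A.1 := by
        have h3 := (Measure.measurable_coe A.2).comp h1
        have h4 : (fun c : Config M => c.count A.1) =
            fun c => ⌊(c.toMeasure A.1).toReal⌋₊ := by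
          funext c; simp [Config.toMeasure_apply _ A.2]
        rw [h4]
        exact Nat.measurable_floor.comp (ENNReal.measurable_toReal.comp h3)
      exact h2.comap_le
    · exact Measurable.comap_le (measurable_pi_lambda _ fun s =>
        Config.measurable_count (hSm s.1 s.2))
  exact (congrArg (@MeasurableSpace.CountablyGenerated (Config M)) hle).mpr
    (MeasurableSpace.CountablyGenerated.comap counts)

end Configurations

/-! ### Rotations of the sphere: invariance of area and transitivity. -/

section Rotations

theorem Rotation.continuous_act (O : Rotation) : Continuous O.act :=
  Continuous.subtype_mk (O.1.continuous.comp continuous_subtype_val) _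

theorem Rotation.measurable_act (O : Rotation) : Measurable O.act :=
  O.continuous_act.measurable

open scoped Pointwise in
-- The area of a set is, up to a constant, the volume of the cone over it, and linear isometries
-- preserve volume.
theorem Rotation.measurePreserving_act (O : Rotation) : MeasurePreserving O.act area area := by
  refine ⟨O.measurable_act, ?_⟩
  ext s hs
  rw [Measure.map_apply O.measurable_act hs, area, Measure.toSphere_apply' _ hs,
    Measure.toSphere_apply' _ (O.measurable_act hs)]
  congr 1
  have hO : MeasurePreserving O.1 (volume : Measure E3) volume := O.1.measurePreserving
  have himg : O.1 ⁻¹' (Set.Ioo (0 : ℝ) 1 • ((↑) '' s : Set E3)) =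
      Set.Ioo (0 : ℝ) 1 • ((↑) '' (O.act ⁻¹' s) : Set E3) := by
    ext v
    simp only [Set.mem_preimage, Set.mem_smul, Set.mem_image]
    constructor
    · rintro ⟨t, ht, _, ⟨x, hx, rfl⟩, h⟩
      have hx' : O.act ⟨O.1.symm x, by simp⟩ = x := by ext1; simp [Rotation.act]
      refine ⟨t, ht, _, ⟨⟨O.1.symm x, by simp⟩, by rwa [hx'], rfl⟩, ?_⟩
      apply O.1.injective
      rw [← h]; simp
    · rintro ⟨t, ht, _, ⟨x, hx, rfl⟩, rfl⟩
      exact ⟨t, ht, _, ⟨O.act x, hx, rfl⟩, by simp [Rotation.act]⟩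
  rw [← himg, ← LinearIsometryEquiv.coe_toMeasurableEquiv,
    (show MeasurePreserving O.1.toMeasurableEquiv volume volume from hO).measure_preimage_equiv]

/-- The rotation is a half-turn about a line: reflection in a line of `ℝ³` negates a plane, so its
determinant is `(-1)² = 1`. The axis is spanned by `x + y`, or by any vector orthogonal to `x` when
`x = -y`. -/
theorem exists_rotation (x y : S2) : ∃ O : Rotation, O.act x = y := by
  by_cases h : (x : E3) = -y
  · obtain ⟨w, hw, hxw⟩ : ∃ w : E3, w ≠ 0 ∧ inner ℝ (x : E3) w = 0 := by
      have : (ℝ ∙ (x : E3))ᗮ ≠ ⊥ := by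
        intro hbot
        have h1 := Submodule.finrank_add_finrank_orthogonal (ℝ ∙ (x : E3))
        rw [hbot, finrank_bot, finrank_span_singleton (ne_zero_of_mem_unit_sphere x)] at h1
        simp at h1
      obtain ⟨w, hw, hw0⟩ := Submodule.exists_mem_ne_zero_of_ne_bot this
      exact ⟨w, hw0, Submodule.mem_orthogonal_singleton_iff_inner_right.1 hw⟩
    refine ⟨⟨(ℝ ∙ w).reflection, ?_⟩, ?_⟩
    · have := (ℝ ∙ w).det_reflection
      have h1 := Submodule.finrank_add_finrank_orthogonal (ℝ ∙ w)
      rw [finrank_span_singleton hw] at h1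
      simp at h1
      rw [show Module.finrank ℝ (ℝ ∙ w)ᗮ = 2 by omega] at this
      simpa using this
    · ext1
      simp only [Rotation.act]
      rw [Submodule.reflection_mem_subspace_orthogonalComplement_eq_neg
        (Submodule.mem_orthogonal_singleton_iff_inner_left.2 hxw), h, neg_neg]
  · set w : E3 := x + y with hw
    have hw0 : w ≠ 0 := fun h0 => h (eq_neg_of_add_eq_zero_left h0)
    refine ⟨⟨(ℝ ∙ w).reflection, ?_⟩, ?_⟩
    · have := (ℝ ∙ w).det_reflection
      have h1 := Submodule.finrank_add_finrank_orthogonal (ℝ ∙ w)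
      rw [finrank_span_singleton hw0] at h1
      simp at h1
      rw [show Module.finrank ℝ (ℝ ∙ w)ᗮ = 2 by omega] at this
      simpa using this
    · ext1
      simp only [Rotation.act]
      have h2 := Submodule.reflection_sub (F := E3) (v := x) (w := -y) (by simp)
      rw [sub_neg_eq_add, ← hw, Submodule.reflection_orthogonal] at h2
      simpa using congrArg Neg.neg h2

theorem measurableSet_geoBall (y : S2) (r : ℝ) : MeasurableSet (geoBall y r) := by
  have : Measurable fun x : S2 => InnerProductGeometry.angle (y : E3) (x : E3) := by
    unfold InnerProductGeometry.angle
    refine Real.continuous_arccos.measurable.comp ?_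
    fun_prop
  exact this measurableSet_Iic

theorem Rotation.act_mem_geoBall (O : Rotation) (x y : S2) (r : ℝ) :
    O.act x ∈ geoBall (O.act y) r ↔ x ∈ geoBall y r := by
  simp only [geoBall, Set.mem_ofPred_eq]
  rw [show InnerProductGeometry.angle (O.act y : E3) (O.act x : E3) =
    InnerProductGeometry.angle (y : E3) (x : E3) from O.1.toLinearIsometry.angle_map y x]

variable {M : Type*} [MeasurableSpace M]

theorem Rotation.measurePreserving_actMarked (O : Rotation) (ν : Measure M) [SigmaFinite ν] :
    MeasurePreserving (O.actMarked : S2 × M → S2 × M) (area.prod ν) (area.prod ν) :=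
  O.measurePreserving_act.prod (MeasurePreserving.id ν)

theorem measurePreserving_pi_const {α : Type*} [MeasurableSpace α] {μ : Measure α}
    [SigmaFinite μ] {f : α → α} (hf : MeasurePreserving f μ μ) (n : ℕ) :
    MeasurePreserving (fun (z : Fin n → α) i => f (z i)) (Measure.pi fun _ => μ)
      (Measure.pi fun _ => μ) :=
  measurePreserving_pi (fun _ => μ) (fun _ => μ) fun _ => hf

theorem sigmaFinite_pi_const {α : Type*} [MeasurableSpace α] (μ : Measure α)
    [SigmaFinite μ] (n : ℕ) : SigmaFinite (Measure.pi fun _ : Fin n => μ) := inferInstance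

theorem Rotation.measurePreserving_tuple (O : Rotation) (ν : Measure M) [SigmaFinite ν] (n : ℕ) :
    MeasurePreserving (fun (z : Fin n → S2 × M) i => O.actMarked (z i))
      (refMeasurePow ν n) (refMeasurePow ν n) :=
  measurePreserving_pi_const (O.measurePreserving_actMarked ν) n

instance (ν : Measure M) [SigmaFinite ν] (n : ℕ) : SigmaFinite (refMeasurePow ν n) :=
  sigmaFinite_pi_const _ n

instance : SigmaFinite area := inferInstance

theorem area_ne_zero : area ≠ 0 := Measure.toSphere_ne_zero _

end Rotations

/-! ### Combinatorics of correlation functions and set partitions. -/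

section Correlations

variable {M : Type*} {ρ : (n : ℕ) → (Fin n → S2 × M) → ℝ≥0}

theorem IsIRWMI.intensity_pos (hiso : IsIRWMI ρ) (z : S2 × M) : 0 < intensity ρ z :=
  hiso.1.trans_le (csInf_le (OrderBot.bddBelow _) ⟨z, by simp, rfl⟩)

theorem reweighted_one (hpos : ∀ z, 0 < intensity ρ z) (z : Fin 1 → S2 × M) :
    reweighted ρ 1 z = 1 := by
  have h : z = fun _ => z 0 := funext fun i => by rw [Subsingleton.elim i 0]
  simp only [reweighted, Finset.univ_unique, Finset.prod_singleton, intensity]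
  have h2 : ρ 1 z = ρ 1 fun _ => z default := congrArg _ h
  rw [h2]
  exact div_self (hpos (z 0)).ne'

theorem IsIRWMI.reweighted_rotate (hiso : IsIRWMI ρ) {n : ℕ} (hn : 1 ≤ n)
    (z : Fin n → S2 × M) (O : Rotation) :
    reweighted ρ n (fun i => O.actMarked (z i)) = reweighted ρ n z := by
  rcases hn.eq_or_lt with rfl | hn
  · rw [reweighted_one hiso.intensity_pos, reweighted_one hiso.intensity_pos]
  · apply NNReal.coe_injective
    rw [← sum_partitions_correlation ρ n hn, ← sum_partitions_correlation ρ n hn]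
    refine Finset.sum_congr rfl fun Q _ => Finset.prod_congr rfl fun B hB => ?_
    exact (hiso.2 B.card (Finset.card_pos.2 (Q.nonempty_of_mem_parts hB))
      (z ∘ B.orderEmbOfFin rfl) O).symm

/-- The cardinality of a block is often only propositionally equal to the expected number. This
allows any increasing enumeration of the block to be used. -/
theorem correlation_block {N k : ℕ} (w : Fin N → S2 × M) (B : Finset (Fin N))
    (f : Fin k ↪o Fin N) (hf : B = Finset.univ.map f.toEmbedding) :
    correlation ρ B.card (w ∘ B.orderEmbOfFin rfl) = correlation ρ k (w ∘ f) := by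
  obtain rfl : B.card = k := by rw [hf]; simp
  rw [← Finset.orderEmbOfFin_unique' (f := f) rfl fun x => (Finset.ext_iff.1 hf _).2 (by simp)]

theorem sum_partitions_correlation_of_pos (hpos : ∀ z, 0 < intensity ρ z) {n : ℕ} (hn : 1 ≤ n)
    (z : Fin n → S2 × M) :
    ∑ Q : Finpartition (Finset.univ : Finset (Fin n)),
      ∏ B ∈ Q.parts, correlation ρ B.card (z ∘ B.orderEmbOfFin rfl) = reweighted ρ n z := by
  rcases hn.eq_or_lt with rfl | hn
  · have hat : IsAtom (Finset.univ : Finset (Fin 1)) := Finset.isAtom_iff.2 ⟨0, rfl⟩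
    let _ : Unique (Finpartition (Finset.univ : Finset (Fin 1))) :=
      IsAtom.uniqueFinpartition (P := Finpartition.indiscrete hat.1) hat
    have hne : (Finset.univ : Finset (Fin 1)) ≠ ⊥ := Finset.univ_nonempty.ne_empty
    rw [Fintype.sum_eq_single (Finpartition.indiscrete hne)
      fun Q hQ => (hQ (Subsingleton.elim _ _)).elim, reweighted_one hpos,
      Finpartition.indiscrete_parts, Finset.prod_singleton,
      correlation_block z _ (RelEmbedding.refl (· ≤ ·)) (by ext; simp), correlation]
    rfl
  · exact sum_partitions_correlation ρ n hn z

/-- Partitions of `{0,…,n}` having the block `{0}` correspond to partitions of `{1,…,n}`. -/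
theorem sum_partitions_singleton_zero {R : Type*} [CommSemiring R] {n : ℕ}
    (F : Finset (Fin (n + 1)) → R) (G : Finset (Fin n) → R)
    (h0 : F {0} = 1) (hFG : ∀ B, F (B.map (Fin.succEmb n)) = G B) :
    ∑ Q ∈ Finset.univ.filter fun Q : Finpartition (Finset.univ : Finset (Fin (n + 1))) =>
        {0} ∈ Q.parts, ∏ B ∈ Q.parts, F B =
      ∑ Q : Finpartition (Finset.univ : Finset (Fin n)), ∏ B ∈ Q.parts, G B := by
  classical
  let shift : Finset (Fin n) ↪ Finset (Fin (n + 1)) := (Finset.mapEmbedding (Fin.succEmb n)).toEmbedding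
  have hs : ∀ B, shift B = B.map (Fin.succEmb n) := fun _ => rfl
  have hnot : ∀ P : Finset (Finset (Fin n)), ({0} : Finset (Fin (n + 1))) ∉ P.map shift := by
    intro P hP
    obtain ⟨B, -, hB⟩ := Finset.mem_map.1 hP
    have : (0 : Fin (n + 1)) ∈ shift B := by rw [hB]; simp
    obtain ⟨i, -, hi⟩ := Finset.mem_map.1 (by rwa [hs] at this)
    exact Fin.succ_ne_zero i hi
  symm
  -- The bijection shifts all blocks up by one and adjoins `{0}`. Its inverse pulls back along
  -- `Fin.succ` every block other than `{0}`.
  refine Finset.sum_bij (fun Q _ => Finpartition.ofExistsUnique (insert {0} (Q.parts.map shift))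
    (fun _ _ => Finset.subset_univ _) ?_ ?_) ?_ ?_ ?_ ?_
  · intro a _
    induction a using Fin.cases with
    | zero =>
      refine ⟨{0}, by simp, ?_⟩
      rintro t ⟨ht, h0t⟩
      rcases Finset.mem_insert.1 ht with rfl | ht
      · rfl
      · obtain ⟨B, -, rfl⟩ := Finset.mem_map.1 ht
        obtain ⟨i, -, hi⟩ := Finset.mem_map.1 h0t
        exact (Fin.succ_ne_zero i hi).elim
    | succ i =>
      obtain ⟨B, ⟨hB, hiB⟩, hu⟩ := Q.existsUnique_mem (Finset.mem_univ i)
      refine ⟨shift B, ⟨Finset.mem_insert_of_mem (Finset.mem_map_of_mem _ hB), ?_⟩, ?_⟩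
      · exact Finset.mem_map.2 ⟨i, hiB, rfl⟩
      rintro t ⟨ht, hit⟩
      rcases Finset.mem_insert.1 ht with rfl | ht
      · simp at hit
      · obtain ⟨B', hB', rfl⟩ := Finset.mem_map.1 ht
        obtain ⟨i', hi', he⟩ := Finset.mem_map.1 hit
        obtain rfl : i' = i := Fin.succ_injective n he
        rw [hu B' ⟨hB', hi'⟩]
  · intro h
    rcases Finset.mem_insert.1 h with h | h
    · simp at h
    · obtain ⟨B, hB, he⟩ := Finset.mem_map.1 h
      exact Q.ne_empty hB (Finset.map_eq_empty.1 he)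
  · intro Q _
    simp [Finpartition.ofExistsUnique]
  · intro Q _ Q' _ h
    ext1
    have h := congrArg Finpartition.parts h
    simp only [Finpartition.ofExistsUnique] at h
    have h2 := congrArg (fun P => P.erase {0}) h
    simp only [Finset.erase_insert (hnot _)] at h2
    exact Finset.map_injective shift h2
  · intro Q hQ
    have hQ0 : {0} ∈ Q.parts := by simpa using hQ
    have hsub : ∀ t ∈ Q.parts, t ≠ {0} → ∃ B, shift B = t := by
      intro t ht hne
      refine ⟨Finset.univ.filter fun i => i.succ ∈ t, ?_⟩
      ext a
      rw [hs]
      induction a using Fin.cases with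
      | zero =>
        have : (0 : Fin (n + 1)) ∉ t := fun h0t =>
          hne (Q.eq_of_mem_parts ht hQ0 h0t (Finset.mem_singleton_self 0))
        simp [this]
      | succ i => simp
    refine ⟨Finpartition.ofExistsUnique (Finset.univ.filter fun B => shift B ∈ Q.parts)
      (fun _ _ => Finset.subset_univ _) ?_ ?_, Finset.mem_univ _, ?_⟩
    · intro i _
      obtain ⟨t, ⟨ht, hit⟩, hu⟩ := Q.existsUnique_mem (Finset.mem_univ i.succ)
      obtain ⟨B, rfl⟩ := hsub t ht (by rintro rfl; simp at hit)
      refine ⟨B, ⟨by simpa using ht, ?_⟩, ?_⟩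
      · obtain ⟨i', hi', he⟩ := Finset.mem_map.1 hit
        rwa [Fin.succ_injective n he] at hi'
      · rintro B' ⟨hB', hiB'⟩
        exact shift.injective (hu _ ⟨by simpa using hB', Finset.mem_map.2 ⟨i, hiB', rfl⟩⟩)
    · intro h
      exact Q.ne_empty (Finset.mem_filter.1 h).2 (by rw [hs]; simp)
    · ext t
      simp only [Finpartition.ofExistsUnique, Finset.mem_insert, Finset.mem_map,
        Finset.mem_filter, Finset.mem_univ, true_and]
      constructor
      · rintro (rfl | ⟨B, hB, rfl⟩) <;> assumption
      · intro ht
        by_cases h : t = {0}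
        · exact Or.inl h
        · obtain ⟨B, rfl⟩ := hsub t ht h
          exact Or.inr ⟨B, ht, rfl⟩
  · intro Q _
    simp only [Finpartition.ofExistsUnique]
    rw [Finset.prod_insert (hnot _), h0, one_mul, Finset.prod_map]
    exact Finset.prod_congr rfl fun B _ => (hFG B).symm

/-- If the zeroth point is uncorrelated with the remaining ones, in the sense that the reweighted
intensities factorize, then the correlation functions involving it vanish. -/
theorem correlation_eq_zero (hpos : ∀ z, 0 < intensity ρ z) (n : ℕ) (hn : 1 ≤ n)
    (w : Fin (n + 1) → S2 × M)
    (hw : ∀ k, 1 ≤ k → ∀ e : Fin k ↪o Fin n,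
      reweighted ρ (k + 1) (Fin.cons (w 0) fun i => w (e i).succ) =
        reweighted ρ k fun i => w (e i).succ) :
    correlation ρ (n + 1) w = 0 := by
  induction n using Nat.strong_induction_on with
  | _ n ih =>
  have hne : (Finset.univ : Finset (Fin (n + 1))) ≠ ⊥ := Finset.univ_nonempty.ne_empty
  let F : Finset (Fin (n + 1)) → ℝ := fun B => correlation ρ B.card (w ∘ B.orderEmbOfFin rfl)
  let G : Finset (Fin n) → ℝ := fun B =>
    correlation ρ B.card ((w ∘ Fin.succ) ∘ B.orderEmbOfFin rfl)
  have hsum : ∑ Q : Finpartition (Finset.univ : Finset (Fin (n + 1))), ∏ B ∈ Q.parts, F B =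
      reweighted ρ (n + 1) w := sum_partitions_correlation_of_pos hpos (by omega) w
  have hsum' : ∑ Q : Finpartition (Finset.univ : Finset (Fin n)), ∏ B ∈ Q.parts, G B =
      reweighted ρ n (w ∘ Fin.succ) := sum_partitions_correlation_of_pos hpos hn _
  have hfac : reweighted ρ (n + 1) w = reweighted ρ n (w ∘ Fin.succ) := by
    have := hw n hn (RelEmbedding.refl (· ≤ ·))
    rwa [show (Fin.cons (w 0) fun i => w ((RelEmbedding.refl (· ≤ ·) : Fin n ↪o Fin n) i).succ :
      Fin (n + 1) → S2 × M) = w from Fin.cons_self_tail w] at this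
  have h0 : F {0} = 1 := by
    let f : Fin 1 ↪o Fin (n + 1) := OrderEmbedding.ofStrictMono (fun _ => 0)
      fun a b hab => (hab.ne (Subsingleton.elim a b)).elim
    have : F {0} = correlation ρ 1 (w ∘ f) := correlation_block w {0} f (by ext a; simp [f]; rfl)
    rw [this, correlation]
  have hFG : ∀ B, F (B.map (Fin.succEmb n)) = G B := by
    intro B
    refine correlation_block w _ ((B.orderEmbOfFin rfl).trans (Fin.succOrderEmb n)) ?_
    ext a
    simp only [Finset.mem_map, Finset.mem_univ, true_and]
    constructor
    · rintro ⟨b, hb, rfl⟩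
      obtain ⟨i, rfl⟩ : b ∈ Set.range (B.orderEmbOfFin rfl) := by simpa using hb
      exact ⟨i, rfl⟩
    · rintro ⟨i, rfl⟩
      exact ⟨B.orderEmbOfFin rfl i, by simp, rfl⟩
  -- The factorization hypothesis is inherited by subtuples that contain the zeroth point, so the
  -- induction hypothesis applies to such blocks. Their increasing enumeration starts at `0`.
  have hvan : ∀ B : Finset (Fin (n + 1)), 0 ∈ B → B ≠ {0} → B ≠ Finset.univ → F B = 0 := by
    intro B hB0 hB1 hBu
    obtain ⟨k, hk⟩ : ∃ k, B.card = k + 1 := ⟨B.card - 1, by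
      have := Finset.card_pos.2 ⟨0, hB0⟩; omega⟩
    have hkn : k < n := by
      have := Finset.card_lt_card ((Finset.ssubset_univ_iff).2 hBu)
      simp at this; omega
    have hk1 : 1 ≤ k := by
      by_contra! hk0
      have hc : B.card = 1 := by omega
      obtain ⟨b, rfl⟩ := Finset.card_eq_one.1 hc
      exact hB1 (by rw [Finset.mem_singleton.1 hB0])
    let f : Fin (k + 1) ↪o Fin (n + 1) := B.orderEmbOfFin hk
    have hrange : Set.range f = B := by simp [f]
    have hf0 : f 0 = 0 := by
      obtain ⟨i, hi⟩ : (0 : Fin (n + 1)) ∈ Set.range f := by rw [hrange]; exact hB0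
      exact le_antisymm (hi ▸ f.monotone (Fin.zero_le i)) (Fin.zero_le _)
    have hfs : ∀ i : Fin k, f i.succ ≠ 0 := fun i h =>
      Fin.succ_ne_zero i (f.injective (h.trans hf0.symm))
    let e' : Fin k ↪o Fin n := OrderEmbedding.ofStrictMono (fun i => (f i.succ).pred (hfs i))
      fun a b hab => Fin.pred_lt_pred_iff.2 (f.strictMono (Fin.succ_lt_succ_iff.2 hab))
    have he' : ∀ i, (e' i).succ = f i.succ := fun i => Fin.succ_pred _ (hfs i)
    have hF : F B = correlation ρ (k + 1) (w ∘ f) := correlation_block w B f (by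
      apply Finset.coe_injective; simp [hrange])
    rw [hF]
    refine ih k hkn hk1 _ fun j hj e => ?_
    have := hw j hj (e.trans e')
    simpa [he', hf0] using this
  -- Partitions with the block `{0}` already sum to the full right-hand side. The others therefore
  -- sum to zero, and among them only the one-block partition has no vanishing factor.
  rw [← Finset.sum_filter_add_sum_filter_not _ fun Q => {0} ∈ Q.parts,
    sum_partitions_singleton_zero F G h0 hFG, hsum', hfac, add_eq_left,
    Finset.sum_eq_single (Finpartition.indiscrete hne)] at hsum
  · rw [Finpartition.indiscrete_parts, Finset.prod_singleton] at hsum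
    rw [← hsum]
    exact (correlation_block w _ (RelEmbedding.refl (· ≤ ·)) (by ext; simp)).symm
  · intro Q hQ hQi
    obtain ⟨B, hB, hB0⟩ := Q.exists_mem (Finset.mem_univ 0)
    refine Finset.prod_eq_zero hB (hvan B hB0 ?_ ?_)
    · rintro rfl
      exact (Finset.mem_filter.1 hQ).2 hB
    · rintro rfl
      apply hQi
      ext1
      rw [Finpartition.indiscrete_parts]
      refine Finset.eq_singleton_iff_unique_mem.2 ⟨hB, fun t ht => ?_⟩
      obtain ⟨i, hi⟩ := Q.nonempty_of_mem_parts ht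
      exact Q.eq_of_mem_parts ht hB hi (Finset.mem_univ i)
  · intro h
    exfalso
    apply h
    simp only [Finset.mem_filter, Finset.mem_univ, true_and, Finpartition.indiscrete_parts,
      Finset.mem_singleton]
    intro h0
    have := congrArg Finset.card h0
    simp at this
    omega

end Correlations

/-! ### Elementary symmetric sums of weights in `[0,1]`. -/

section ElementarySymmetric

variable {α : Type*}

/-- The `n`-th elementary symmetric polynomial of the family `(u a)_{a ∈ s}`. -/
def elemSymm {R : Type*} [CommSemiring R] (s : Finset α) (u : α → R) (n : ℕ) : R :=
  ∑ t ∈ s.powersetCard n, ∏ a ∈ t, u a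

theorem elemSymm_zero {R : Type*} [CommSemiring R] (s : Finset α) (u : α → R) :
    elemSymm s u 0 = 1 := by simp [elemSymm]

theorem elemSymm_eq_zero {R : Type*} [CommSemiring R] {s : Finset α} (u : α → R) {n : ℕ}
    (hn : s.card < n) : elemSymm s u n = 0 := by
  rw [elemSymm, Finset.powersetCard_eq_empty.2 hn, Finset.sum_empty]

theorem elemSymm_empty_succ {R : Type*} [CommSemiring R] (u : α → R) (n : ℕ) :
    elemSymm ∅ u (n + 1) = 0 := elemSymm_eq_zero u (by simp)

theorem elemSymm_insert_succ [DecidableEq α] {s : Finset α} {a : α} (ha : a ∉ s) (u : α → ℝ)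
    (n : ℕ) :
    elemSymm (insert a s) u (n + 1) = elemSymm s u (n + 1) + u a * elemSymm s u n := by
  have hmem : ∀ t ∈ s.powersetCard n, a ∉ t := fun t ht h =>
    ha ((Finset.mem_powersetCard.1 ht).1 h)
  unfold elemSymm
  rw [Finset.powersetCard_succ_insert ha, Finset.sum_union, Finset.sum_image, Finset.mul_sum]
  · congr 1
    exact Finset.sum_congr rfl fun t ht => Finset.prod_insert (hmem t ht)
  · intro t ht t' ht' h
    have := congrArg (fun x => x.erase a) h
    simpa [Finset.erase_insert (hmem t ht), Finset.erase_insert (hmem t' ht')] using this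
  · rw [Finset.disjoint_left]
    intro t ht ht'
    obtain ⟨t', -, rfl⟩ := Finset.mem_image.1 ht'
    exact ha ((Finset.mem_powersetCard.1 ht).1 (Finset.mem_insert_self a t'))

theorem elemSymm_nonneg {s : Finset α} {u : α → ℝ} (h0 : ∀ a, 0 ≤ u a) (n : ℕ) :
    0 ≤ elemSymm s u n :=
  Finset.sum_nonneg fun _ _ => Finset.prod_nonneg fun a _ => h0 a

theorem elemSymm_le_pow (s : Finset α) {u : α → ℝ} (h0 : ∀ a, 0 ≤ u a) (n : ℕ) :
    elemSymm s u n ≤ (∑ a ∈ s, u a) ^ n := by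
  classical
  induction s using Finset.induction_on generalizing n with
  | empty =>
    cases n with
    | zero => simp [elemSymm_zero]
    | succ n => simp [elemSymm_empty_succ]
  | insert a s ha ih =>
    cases n with
    | zero => simp [elemSymm]
    | succ n =>
      have hS : 0 ≤ ∑ a ∈ s, u a := Finset.sum_nonneg fun a _ => h0 a
      rw [elemSymm_insert_succ ha, Finset.sum_insert ha]
      calc elemSymm s u (n + 1) + u a * elemSymm s u n
          ≤ (∑ a ∈ s, u a) ^ (n + 1) + u a * (∑ a ∈ s, u a) ^ n :=
            add_le_add (ih _) (mul_le_mul_of_nonneg_left (ih _) (h0 a))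
        _ = (∑ a ∈ s, u a) ^ n * (u a + ∑ a ∈ s, u a) := by ring
        _ ≤ (u a + ∑ a ∈ s, u a) ^ n * (u a + ∑ a ∈ s, u a) :=
            mul_le_mul_of_nonneg_right
              (pow_le_pow_left₀ hS (le_add_of_nonneg_left (h0 a)) n) (add_nonneg (h0 a) hS)
        _ = _ := (pow_succ _ _).symm

/-- Multiplying the `n`-th sum by `∑ u` gives `n + 1` times the next one, plus terms with a repeated
index. These number `n` per subset, and each is at most the product over the subset because `u ≤ 1`.
-/
theorem elemSymm_mul_sum_sub_le (s : Finset α) {u : α → ℝ} (h0 : ∀ a, 0 ≤ u a)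
    (h1 : ∀ a, u a ≤ 1) (n : ℕ) :
    elemSymm s u n * (∑ a ∈ s, u a - n) ≤ (n + 1) * elemSymm s u (n + 1) := by
  classical
  induction s using Finset.induction_on generalizing n with
  | empty =>
    cases n with
    | zero => simp [elemSymm_zero, elemSymm_empty_succ]
    | succ n => simp [elemSymm_empty_succ]
  | insert a s ha ih =>
    have ihn := ih n
    rw [Finset.sum_insert ha, elemSymm_insert_succ ha]
    cases n with
    | zero =>
      simp only [elemSymm_zero, Nat.cast_zero] at ihn ⊢
      linarith
    | succ n =>
      have ihm := mul_le_mul_of_nonneg_left (ih n) (h0 a)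
      have hu : 0 ≤ u a * elemSymm s u n * (1 - u a) :=
        mul_nonneg (mul_nonneg (h0 a) (elemSymm_nonneg h0 n)) (sub_nonneg.2 (h1 a))
      rw [elemSymm_insert_succ ha]
      push_cast at ihn ihm ⊢
      nlinarith

/-- Finiteness of a higher moment descends to the lower ones by this bound. If `∑ u ≥ n + 1` the
previous inequality suffices; otherwise the sum is at most `(n + 1) ^ n`. -/
theorem elemSymm_le_succ (s : Finset α) {u : α → ℝ} (h0 : ∀ a, 0 ≤ u a) (h1 : ∀ a, u a ≤ 1)
    (n : ℕ) : elemSymm s u n ≤ (n + 1) * elemSymm s u (n + 1) + (n + 1) ^ n := by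
  have he := elemSymm_nonneg (s := s) h0 n
  have he' := elemSymm_nonneg (s := s) h0 (n + 1)
  rcases le_total ((n : ℝ) + 1) (∑ a ∈ s, u a) with h | h
  · have h2 := elemSymm_mul_sum_sub_le s h0 h1 n
    have h3 : elemSymm s u n * 1 ≤ elemSymm s u n * (∑ a ∈ s, u a - n) :=
      mul_le_mul_of_nonneg_left (by linarith) he
    have : (0 : ℝ) ≤ (n + 1) ^ n := by positivity
    linarith
  · have h2 := elemSymm_le_pow s h0 n
    have h3 := pow_le_pow_left₀ (Finset.sum_nonneg fun a _ => h0 a) h n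
    have : 0 ≤ ((n : ℝ) + 1) * elemSymm s u (n + 1) := by positivity
    linarith

theorem hasSum_elemSymm (s : Finset α) (u : α → ℝ) :
    HasSum (fun n => (-1) ^ n * elemSymm s u n) (∏ a ∈ s, (1 - u a)) := by
  have h : ∏ a ∈ s, (1 - u a) =
      ∑ n ∈ Finset.range (s.card + 1), (-1) ^ n * elemSymm s u n := by
    simp only [sub_eq_add_neg, Finset.prod_one_add, Finset.sum_powerset, elemSymm,
      Finset.mul_sum]
    refine Finset.sum_congr rfl fun n _ => Finset.sum_congr rfl fun t ht => ?_
    rw [Finset.prod_neg, (Finset.mem_powersetCard.1 ht).2]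
  rw [h]
  refine hasSum_sum_of_ne_finset_zero fun n hn => ?_
  rw [Finset.mem_range, not_lt] at hn
  rw [elemSymm_eq_zero u (by omega), mul_zero]

theorem card_injective_tuples [DecidableEq α] {n : ℕ} {s t : Finset α} (ht : t ∈ s.powersetCard n) :
    (((Fintype.piFinset fun _ : Fin n => s).filter Function.Injective).filter
      fun z => Finset.univ.image z = t).card = n ! := by
  classical
  obtain ⟨hts, htc⟩ := Finset.mem_powersetCard.1 ht
  have h1 : Fintype.card (Fin n ↪ t) = n ! := by
    rw [Fintype.card_embedding_eq, Fintype.card_coe, htc, Fintype.card_fin, Nat.descFactorial_self]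
  rw [← h1, ← Finset.card_univ]
  symm
  refine Finset.card_bij (fun f _ i => (f i).1) ?_ ?_ ?_
  · intro f _
    have hinj : Function.Injective fun i => (f i).1 := Subtype.val_injective.comp f.injective
    simp only [Finset.mem_filter, Fintype.mem_piFinset]
    refine ⟨⟨fun i => hts (f i).2, hinj⟩, Finset.eq_of_subset_of_card_le ?_ ?_⟩
    · intro a ha
      obtain ⟨i, -, rfl⟩ := Finset.mem_image.1 ha
      exact (f i).2
    · rw [Finset.card_image_of_injective _ hinj, htc, Finset.card_univ, Fintype.card_fin]
  · intro f _ g _ h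
    ext i
    exact congrFun h i
  · intro z hz
    obtain ⟨⟨-, hinj⟩, himg⟩ := by simpa only [Finset.mem_filter] using hz
    refine ⟨⟨fun i => ⟨z i, himg ▸ Finset.mem_image_of_mem z (Finset.mem_univ i)⟩,
      fun i j h => hinj (congrArg Subtype.val h)⟩, Finset.mem_univ _, rfl⟩

end ElementarySymmetric

/-! ### Expansion of the generating functional in factorial moments. -/

section Expansion

variable {M : Type*}

theorem Config.sum_distinctTuples_prod {R : Type*} [CommSemiring R] (c : Config M)
    (u : S2 × M → R) (n : ℕ) :
    ∑ z ∈ c.distinctTuples n, ∏ i, u (z i) = (n ! : R) * elemSymm c.points u n := by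
  classical
  have hmaps : ∀ z ∈ c.distinctTuples n, Finset.univ.image z ∈ c.points.powersetCard n := by
    intro z hz
    obtain ⟨hz, hinj⟩ := Finset.mem_filter.1 hz
    rw [Finset.mem_powersetCard, Finset.card_image_of_injective _ hinj]
    refine ⟨fun a ha => ?_, by simp⟩
    obtain ⟨i, -, rfl⟩ := Finset.mem_image.1 ha
    exact Fintype.mem_piFinset.1 hz i
  rw [← Finset.sum_fiberwise_of_maps_to hmaps, elemSymm, Finset.mul_sum]
  refine Finset.sum_congr rfl fun t ht => ?_
  rw [← card_injective_tuples ht, ← nsmul_eq_mul, ← Finset.sum_const]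
  refine Finset.sum_congr (by unfold Config.distinctTuples; congr) fun z hz => ?_
  obtain ⟨⟨-, hinj⟩, rfl⟩ := by simpa only [Finset.mem_filter] using hz
  rw [Finset.prod_image hinj.injOn]

variable [MeasurableSpace M] [MeasurableEq M] {Ω : Type*} [MeasurableSpace Ω]

/-- The generating functional is determined by the factorial moments of `u`, provided that these
decay geometrically. -/
theorem integral_prod_one_sub {Pr : Measure Ω} [IsProbabilityMeasure Pr]
    {ν : Measure M} [SigmaFinite ν] {X : Ω → Config M} (hX : Measurable X)
    {ρ : (n : ℕ) → (Fin n → S2 × M) → ℝ≥0} (hρ : AreIntensityFunctions Pr X ν ρ)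
    {u : S2 × M → ℝ} (hu : Measurable u) (h0 : ∀ z, 0 ≤ u z) (h1 : ∀ z, u z ≤ 1)
    {K : ℕ → ℝ≥0∞}
    (hK : ∀ n, 1 ≤ n →
      ∫⁻ z, ρ n z * ∏ i, ENNReal.ofReal (u (z i)) ∂(refMeasurePow ν n) = n ! * K n)
    {q : ℝ≥0} (hq : q < 1) (hKq : ∀ᶠ n in atTop, K n ≤ (q : ℝ≥0∞) ^ n) :
    ∫ ω, ∏ z ∈ (X ω).points, (1 - u z) ∂Pr =
      ∑' n : ℕ, (-1) ^ n * if n = 0 then 1 else (K n).toReal := by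
  let e : ℕ → Ω → ℝ := fun n ω => elemSymm (X ω).points u n
  have he0 : ∀ n ω, 0 ≤ e n ω := fun n ω => elemSymm_nonneg h0 n
  have hofReal : ∀ n ω, ENNReal.ofReal (e n ω) =
      elemSymm (X ω).points (fun z => ENNReal.ofReal (u z)) n := by
    intro n ω
    simp only [e, elemSymm]
    rw [ENNReal.ofReal_sum_of_nonneg fun _ _ => Finset.prod_nonneg fun a _ => h0 a]
    exact Finset.sum_congr rfl fun t _ => ENNReal.ofReal_prod_of_nonneg fun a _ => h0 a
  have hfac : ∀ n : ℕ, (n ! : ℝ≥0∞) ≠ 0 := fun n => by exact_mod_cast n.factorial_ne_zero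
  have hg : ∀ n, Measurable fun z : Fin n → S2 × M => ∏ i, ENNReal.ofReal (u (z i)) :=
    fun n => Finset.measurable_prod _ fun i _ => by fun_prop
  have htup : ∀ n ω, (n ! : ℝ≥0∞) * ENNReal.ofReal (e n ω) =
      ∑ z ∈ (X ω).distinctTuples n, ∏ i, ENNReal.ofReal (u (z i)) := fun n ω => by
    rw [hofReal]
    exact (Config.sum_distinctTuples_prod (X ω) (fun z => ENNReal.ofReal (u z)) n).symm
  have hmE : ∀ n, Measurable fun ω => ENNReal.ofReal (e n ω) := by
    intro n
    have h2 : (fun ω => ENNReal.ofReal (e n ω)) = fun ω => (n ! : ℝ≥0∞)⁻¹ *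
        ∑ z ∈ (X ω).distinctTuples n, ∏ i, ENNReal.ofReal (u (z i)) := by
      funext ω
      rw [← htup, ← mul_assoc, ENNReal.inv_mul_cancel (hfac n) (by simp), one_mul]
    rw [h2]
    exact ((Config.measurable_sum_distinctTuples (hg n)).comp hX).const_mul _
  have hme : ∀ n, Measurable (e n) := fun n => by
    have := (hmE n).ennreal_toReal
    simpa only [ENNReal.toReal_ofReal (he0 n _)] using this
  have hL : ∀ n, 1 ≤ n → ∫⁻ ω, ENNReal.ofReal (e n ω) ∂Pr = K n := by
    intro n hn
    have h2 := lintegral_sum_distinctTuples hX hρ hn (hg n)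
    rw [hK n hn] at h2
    simp only [← htup] at h2
    rw [lintegral_const_mul _ (hmE n)] at h2
    exact (ENNReal.mul_right_inj (hfac n) (by simp)).1 h2
  -- The decay hypothesis controls only large `n`. The remaining moments are finite by descent with
  -- `elemSymm_le_succ`, whose additive constant is integrable under a probability measure.
  have hfin : ∀ n, ∫⁻ ω, ENNReal.ofReal (e n ω) ∂Pr ≠ ∞ := by
    obtain ⟨N, hN⟩ := eventually_atTop.1 hKq
    have hlarge : ∀ n, N + 1 ≤ n → ∫⁻ ω, ENNReal.ofReal (e n ω) ∂Pr ≠ ∞ := fun n hn => by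
      rw [hL n (by omega)]
      exact ne_top_of_le_ne_top (by finiteness) (hN n (by omega))
    have hstep : ∀ n, ∫⁻ ω, ENNReal.ofReal (e (n + 1) ω) ∂Pr ≠ ∞ →
        ∫⁻ ω, ENNReal.ofReal (e n ω) ∂Pr ≠ ∞ := by
      intro n hn
      refine ne_top_of_le_ne_top ?_ (lintegral_mono fun ω => ENNReal.ofReal_le_ofReal
        (elemSymm_le_succ (X ω).points h0 h1 n))
      have : ∀ ω, ENNReal.ofReal ((n + 1) * elemSymm (X ω).points u (n + 1) + (n + 1) ^ n) =
          ENNReal.ofReal (n + 1) * ENNReal.ofReal (e (n + 1) ω) +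
            ENNReal.ofReal ((n + 1) ^ n) := fun ω => by
        rw [ENNReal.ofReal_add (mul_nonneg (by positivity) (he0 (n + 1) ω)) (by positivity),
          ENNReal.ofReal_mul (by positivity)]
      simp only [this]
      rw [lintegral_add_right _ measurable_const, lintegral_const_mul _ (hmE _), lintegral_const,
        measure_univ, mul_one]
      exact ENNReal.add_ne_top.2 ⟨ENNReal.mul_ne_top (by simp) hn, by simp⟩
    have hdown : ∀ k n, N + 1 ≤ n + k → ∫⁻ ω, ENNReal.ofReal (e n ω) ∂Pr ≠ ∞ := by
      intro k
      induction k with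
      | zero => intro n hn; exact hlarge n (by omega)
      | succ k ih => intro n hn; exact hstep n (ih (n + 1) (by omega))
    exact fun n => hdown (N + 1) n (by omega)
  have hint : ∀ n, Integrable (e n) Pr := fun n =>
    ⟨(hme n).aestronglyMeasurable, by
      rw [hasFiniteIntegral_iff_ofReal (ae_of_all _ (he0 n))]
      exact lt_top_iff_ne_top.2 (hfin n)⟩
  have hval : ∀ n, ∫ ω, e n ω ∂Pr = if n = 0 then 1 else (K n).toReal := by
    intro n
    split_ifs with h
    · subst h; simp [e, elemSymm_zero]
    · rw [integral_eq_lintegral_of_nonneg_ae (ae_of_all _ (he0 n)) (hme n).aestronglyMeasurable,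
        hL n (by omega)]
  -- Absolute summability by comparison with a geometric series; this justifies exchanging the sum
  -- with the expectation.
  have hsum : Summable fun n => ∫ ω, ‖(-1) ^ n * e n ω‖ ∂Pr := by
    have hn : ∀ n, ∫ ω, ‖(-1) ^ n * e n ω‖ ∂Pr = ∫ ω, e n ω ∂Pr := fun n => by
      refine integral_congr_ae (ae_of_all _ fun ω => ?_)
      simp [abs_of_nonneg (he0 n ω)]
    simp only [hn]
    refine Summable.of_norm_bounded_eventually_nat
      (summable_geometric_of_lt_one q.2 (by exact_mod_cast hq)) ?_
    filter_upwards [hKq, eventually_ge_atTop 1] with n hn h1n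
    rw [hval, if_neg (by omega), Real.norm_of_nonneg ENNReal.toReal_nonneg]
    exact ENNReal.toReal_le_of_le_ofReal (pow_nonneg q.2 _) (hn.trans_eq (by
      rw [ENNReal.ofReal_pow q.2]; simp))
  have hmain := hasSum_integral_of_summable_integral_norm
    (F := fun n ω => (-1) ^ n * e n ω) (fun n => (hint n).const_mul _) hsum
  have hprod : ∀ ω, ∑' n, (-1) ^ n * e n ω = ∏ z ∈ (X ω).points, (1 - u z) := fun ω =>
    (hasSum_elemSymm (X ω).points u).tsum_eq
  simp only [hprod, integral_const_mul, hval] at hmain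
  exact hmain.tsum_eq.symm

end Expansion

/-! ### The empty space function does not depend on its centre. -/

section EmptySpace

variable {M : Type*} {ρ : (n : ℕ) → (Fin n → S2 × M) → ℝ≥0}

theorem infIntensity_le {E : Set M} {z : S2 × M} (hz : z.2 ∈ E) :
    infIntensity ρ E ≤ intensity ρ z :=
  csInf_le (OrderBot.bddBelow _) ⟨z, ⟨Set.mem_univ _, hz⟩, rfl⟩

theorem uFun_nonneg (E : Set M) (y : S2) (r : ℝ) (z : S2 × M) : 0 ≤ uFun ρ E y r z :=
  Set.indicator_nonneg (fun _ _ => by positivity) z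

theorem uFun_le_one (E : Set M) (y : S2) (r : ℝ) (z : S2 × M) : uFun ρ E y r z ≤ 1 :=
  Set.indicator_apply_le' (fun hz => div_le_one_of_le₀ (by exact_mod_cast infIntensity_le hz.2)
    (by positivity)) fun _ => zero_le_one

theorem uFun_eq_zero {E : Set M} (y : S2) (r : ℝ) {z : S2 × M} (hz : z.2 ∉ E) :
    uFun ρ E y r z = 0 := Set.indicator_of_notMem (fun h => hz h.2) _

theorem mul_prod_uFun (n : ℕ) (E : Set M) (y : S2) (r : ℝ) (z : Fin n → S2 × M) :
    (ρ n z : ℝ≥0∞) * ∏ i, ENNReal.ofReal (uFun ρ E y r (z i)) =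
      (Set.univ.pi fun _ => geoBall y r ×ˢ E).indicator
        (fun z => ((infIntensity ρ E ^ n : ℝ≥0) : ℝ≥0∞) * (reweighted ρ n z : ℝ≥0∞)) z := by
  by_cases hz : z ∈ Set.univ.pi fun _ : Fin n => geoBall y r ×ˢ E
  · rw [Set.indicator_of_mem hz]
    have h : ∀ i, ENNReal.ofReal (uFun ρ E y r (z i)) =
        ((infIntensity ρ E / intensity ρ (z i) : ℝ≥0) : ℝ≥0∞) := fun i => by
      rw [uFun, Set.indicator_of_mem (hz i (Set.mem_univ i)), ← NNReal.coe_div,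
        ENNReal.ofReal_coe_nnreal]
    simp only [h]
    rw [← ENNReal.ofNNReal_finsetProd, ← ENNReal.coe_mul, ← ENNReal.coe_mul, Finset.prod_div_distrib,
      reweighted, Finset.prod_const, Finset.card_univ, Fintype.card_fin]
    congr 1
    ring
  · rw [Set.indicator_of_notMem hz]
    obtain ⟨i, hi⟩ : ∃ i, z i ∉ geoBall y r ×ˢ E := by simpa [Set.mem_pi] using hz
    rw [Finset.prod_eq_zero (Finset.mem_univ i), mul_zero]
    rw [uFun, Set.indicator_of_notMem hi, ENNReal.ofReal_zero]

variable [MeasurableSpace M] {Ω : Type*} [MeasurableSpace Ω] {Pr : Measure Ω}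
  {ν : Measure M} [SigmaFinite ν] {X : Ω → Config M}

theorem AreIntensityFunctions.measurable_intensity (hρ : AreIntensityFunctions Pr X ν ρ) :
    Measurable (intensity ρ) :=
  (hρ 1 le_rfl).1.comp (measurable_pi_lambda _ fun _ => measurable_id)

theorem AreIntensityFunctions.measurable_reweighted (hρ : AreIntensityFunctions Pr X ν ρ)
    {n : ℕ} (hn : 1 ≤ n) : Measurable (reweighted ρ n) :=
  (hρ n hn).1.div (Finset.measurable_prod _ fun i _ =>
    hρ.measurable_intensity.comp (measurable_pi_apply i))

theorem AreIntensityFunctions.measurable_uFun (hρ : AreIntensityFunctions Pr X ν ρ)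
    {E : Set M} (hE : MeasurableSet E) (y : S2) (r : ℝ) : Measurable (uFun ρ E y r) :=
  (measurable_const.div hρ.measurable_intensity.coe_nnreal_real).indicator
    ((measurableSet_geoBall y r).prod hE)

/-- The denominators in `uFun` turn `ρ n` into the rotation-invariant reweighted intensity. A
rotation that carries the north pole to `y` then moves the cap to the pole, so the right-hand side
is free of `y`. -/
theorem lintegral_mul_prod_uFun (hρ : AreIntensityFunctions Pr X ν ρ) (hiso : IsIRWMI ρ)
    {E : Set M} (hE : MeasurableSet E) (y : S2) (r : ℝ) {n : ℕ} (hn : 1 ≤ n) :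
    ∫⁻ z, ρ n z * ∏ i, ENNReal.ofReal (uFun ρ E y r (z i)) ∂(refMeasurePow ν n) =
      ((infIntensity ρ E ^ n : ℝ≥0) : ℝ≥0∞) *
        ∫⁻ z in capTuples E r n, (reweighted ρ n z : ℝ≥0∞) ∂(refMeasurePow ν n) := by
  obtain ⟨O, rfl⟩ := exists_rotation northPole y
  have hD : ∀ y : S2, MeasurableSet (Set.univ.pi fun _ : Fin n => geoBall y r ×ˢ E) := fun y =>
    MeasurableSet.univ_pi fun _ => (measurableSet_geoBall y r).prod hE
  have hm := (hρ.measurable_reweighted hn).coe_nnreal_ennreal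
  simp only [mul_prod_uFun]
  rw [← (O.measurePreserving_tuple ν n).lintegral_comp ((hm.const_mul _).indicator (hD _)),
    ← lintegral_const_mul _ hm, capTuples,
    ← lintegral_indicator (hD northPole)]
  refine lintegral_congr fun z => ?_
  have hiff : (fun i => O.actMarked (z i)) ∈
      (Set.univ.pi fun _ : Fin n => geoBall (O.act northPole) r ×ˢ E) ↔
      z ∈ Set.univ.pi fun _ : Fin n => geoBall northPole r ×ˢ E := by
    simp [Set.mem_pi, Rotation.actMarked, Rotation.act_mem_geoBall]
  by_cases hz : z ∈ Set.univ.pi fun _ : Fin n => geoBall northPole r ×ˢ E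
  · rw [Set.indicator_of_mem hz, Set.indicator_of_mem (hiff.2 hz), hiso.reweighted_rotate hn]
  · rw [Set.indicator_of_notMem hz, Set.indicator_of_notMem (mt hiff.1 hz)]

/-- The terms of the series in the moment condition. -/
noncomputable def momentTerm (ν : Measure M) [SigmaFinite ν]
    (ρ : (n : ℕ) → (Fin n → S2 × M) → ℝ≥0) (E : Set M) (r : ℝ) (n : ℕ) : ℝ≥0∞ :=
  ((infIntensity ρ E ^ n / (n ! : ℝ≥0) : ℝ≥0) : ℝ≥0∞) *
    ∫⁻ z in capTuples E r n, (reweighted ρ n z : ℝ≥0∞) ∂(refMeasurePow ν n)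

theorem momentTerm_mono (E : Set M) {r R : ℝ} (hr : r ≤ R) (n : ℕ) :
    momentTerm ν ρ E r n ≤ momentTerm ν ρ E R n := by
  unfold momentTerm
  gcongr
  exact Set.pi_mono fun _ _ => Set.prod_mono (fun x hx => le_trans hx hr) subset_rfl

/-- This is the root test: any `q` strictly between the limsup and one works, and smaller radii only
decrease the terms. -/
theorem MomentCondition.exists_geometric {E : Set M} {R : ℝ} (h : MomentCondition ν ρ E R) :
    ∃ q : ℝ≥0, q < 1 ∧ ∀ r ≤ R, ∀ᶠ n : ℕ in atTop, momentTerm ν ρ E r n ≤ (q : ℝ≥0∞) ^ n := by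
  obtain ⟨q, hq, hq1⟩ := exists_between (show limsup (fun n : ℕ =>
    momentTerm ν ρ E R n ^ (1 / (n : ℝ))) atTop < 1 from h)
  lift q to ℝ≥0 using (hq1.trans ENNReal.one_lt_top).ne
  refine ⟨q, by exact_mod_cast hq1, fun r hr => ?_⟩
  filter_upwards [eventually_lt_of_limsup_lt hq, eventually_ge_atTop 1] with n hn h1
  refine (momentTerm_mono E hr n).trans ?_
  have hn0 : (n : ℝ) ≠ 0 := by positivity
  have h2 := ENNReal.rpow_le_rpow hn.le (Nat.cast_nonneg (α := ℝ) n)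
  rwa [← ENNReal.rpow_mul, one_div_mul_cancel hn0, ENNReal.rpow_one, ENNReal.rpow_natCast] at h2

theorem AreIntensityFunctions.measurable_prod_one_sub (hρ : AreIntensityFunctions Pr X ν ρ)
    {E : Set M} (hE : MeasurableSet E) (y : S2) (r : ℝ) :
    Measurable fun c : Config M => ∏ z ∈ c.points, (1 - uFun ρ E y r z) :=
  Config.measurable_prod_points ((hρ.measurable_uFun hE y r).const_sub 1)
    (fun z => sub_nonneg.2 (uFun_le_one E y r z)) fun z => sub_le_self _ (uFun_nonneg E y r z)

/-- The generating functional of an IRWMI process at `1 - u^r_{y,E}` does not depend on `y`. -/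
theorem genFun_uFun_eq_tsum [MeasurableEq M] [IsProbabilityMeasure Pr] (hX : Measurable X)
    (hρ : AreIntensityFunctions Pr X ν ρ) (hiso : IsIRWMI ρ) {E : Set M} (hE : MeasurableSet E)
    {R : ℝ} (hmom : MomentCondition ν ρ E R) (y : S2) {r : ℝ} (hr : r ≤ R) :
    genFun (Pr.map X) (fun z => 1 - uFun ρ E y r z) =
      ∑' n : ℕ, (-1) ^ n * if n = 0 then 1 else (momentTerm ν ρ E r n).toReal := by
  obtain ⟨q, hq, hev⟩ := hmom.exists_geometric
  rw [genFun, integral_map hX.aemeasurable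
    (hρ.measurable_prod_one_sub hE y r).aestronglyMeasurable]
  refine integral_prod_one_sub hX hρ (hρ.measurable_uFun hE y r) (uFun_nonneg E y r)
    (uFun_le_one E y r) (fun n hn => ?_) hq (hev r hr)
  rw [lintegral_mul_prod_uFun hρ hiso hE y r hn, momentTerm, ← mul_assoc]
  congr 1
  have : (n ! : ℝ≥0) ≠ 0 := by exact_mod_cast n.factorial_ne_zero
  rw [← ENNReal.coe_natCast, ← ENNReal.coe_mul, mul_div_cancel₀ _ this]

end EmptySpace

/-! ### Sums and products over the points with marks in a given set. -/

section Restriction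

variable {M : Type*}

theorem Config.sum_points_restrictMarks (c : Config M) {C : Set M} {g : S2 × M → ℝ≥0∞}
    (hg : ∀ z, z.2 ∉ C → g z = 0) :
    ∑ z ∈ (c.restrictMarks C).points, g z = ∑ z ∈ c.points, g z := by
  classical
  simp only [Config.restrictMarks]
  refine Finset.sum_subset (Finset.filter_subset _ _) fun z hz hz' => hg z fun h => hz' ?_
  exact Finset.mem_filter.2 ⟨hz, h⟩

theorem Config.sum_distinctTuples_restrictMarks (c : Config M) {E : Set M} {n : ℕ}
    {h : (Fin n → S2 × M) → ℝ≥0∞} (hh : ∀ z i, (z i).2 ∉ E → h z = 0) :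
    ∑ z ∈ (c.restrictMarks E).distinctTuples n, h z = ∑ z ∈ c.distinctTuples n, h z := by
  classical
  simp only [Config.restrictMarks, Config.distinctTuples]
  refine Finset.sum_subset (Finset.filter_subset_filter _ (Fintype.piFinset_subset _ _ fun _ =>
    Finset.filter_subset _ _)) fun z hz hz' => ?_
  by_contra hne
  refine hz' (Finset.mem_filter.2 ⟨Fintype.mem_piFinset.2 fun i => Finset.mem_filter.2
    ⟨Fintype.mem_piFinset.1 (Finset.mem_filter.1 hz).1 i, ?_⟩, (Finset.mem_filter.1 hz).2⟩)
  by_contra hi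
  exact hne (hh z i hi)

/-- A point with mark in `C` is automatically distinct from points with marks in `E`, so the
distinctness constraint does not couple the two groups and the sum splits into a product. -/
theorem Config.sum_distinctTuples_succ (c : Config M) {C E : Set M} (hCE : Disjoint C E) {n : ℕ}
    {g : S2 × M → ℝ≥0∞} (hg : ∀ z, z.2 ∉ C → g z = 0)
    {h : (Fin n → S2 × M) → ℝ≥0∞} (hh : ∀ z i, (z i).2 ∉ E → h z = 0) :
    ∑ w ∈ c.distinctTuples (n + 1), g (w 0) * h (Fin.tail w) =
      (∑ z ∈ c.points, g z) * ∑ z ∈ c.distinctTuples n, h z := by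
  classical
  simp only [Config.distinctTuples, Finset.sum_filter, Finset.sum_mul_sum]
  rw [← Finset.sum_product']
  refine Finset.sum_nbij' (fun w => (w 0, Fin.tail w)) (fun p => Fin.cons p.1 p.2) ?_ ?_ ?_ ?_ ?_
  · intro w hw
    have hw := Fintype.mem_piFinset.1 hw
    exact Finset.mem_product.2 ⟨hw 0, Fintype.mem_piFinset.2 fun i => hw i.succ⟩
  · intro p hp
    obtain ⟨hp1, hp2⟩ := Finset.mem_product.1 hp
    refine Fintype.mem_piFinset.2 fun i => ?_
    induction i using Fin.cases with
    | zero => exact hp1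
    | succ i => exact Fintype.mem_piFinset.1 hp2 i
  · intro w _
    exact Fin.cons_self_tail w
  · intro p _
    rfl
  · intro w _
    by_cases h0 : (w 0).2 ∈ C
    · by_cases h1 : ∀ i, (Fin.tail w i).2 ∈ E
      · have hiff : Function.Injective w ↔ Function.Injective (Fin.tail w) := by
          rw [← Fin.cons_self_tail w, Fin.cons_injective_iff]
          simp only [Fin.tail_cons, and_iff_right_iff_imp]
          rintro - ⟨i, hi⟩
          exact Set.disjoint_left.1 hCE h0 (hi ▸ h1 i)
        simp only [hiff, mul_ite, mul_zero]
      · obtain ⟨i, hi⟩ := not_forall.1 h1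
        simp [hh _ i hi]
    · simp [hg _ h0]

theorem Config.erase_restrictMarks (c : Config M) {E : Set M} {z : S2 × M} (hz : z.2 ∉ E) :
    (c.erase z).restrictMarks E = c.restrictMarks E := by
  classical
  ext w
  simp only [Config.restrictMarks, Config.erase, Finset.mem_filter, Finset.mem_erase]
  constructor
  · rintro ⟨⟨-, h1⟩, h2⟩
    exact ⟨h1, h2⟩
  · rintro ⟨h1, h2⟩
    exact ⟨⟨by rintro rfl; exact hz h2, h1⟩, h2⟩

theorem Config.prod_points_restrictMarks (c : Config M) {E : Set M} {v : S2 × M → ℝ}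
    (hv : ∀ z, z.2 ∉ E → v z = 1) :
    ∏ z ∈ (c.restrictMarks E).points, v z = ∏ z ∈ c.points, v z := by
  classical
  simp only [Config.restrictMarks]
  refine Finset.prod_subset (Finset.filter_subset _ _) fun z hz hz' => hv z fun h => hz' ?_
  exact Finset.mem_filter.2 ⟨hz, h⟩

end Restriction

/-! ### Palm distributions under independence. -/

section Independence

variable {M : Type*} [MeasurableSpace M] {ρ : (n : ℕ) → (Fin n → S2 × M) → ℝ≥0}
  {Ω : Type*} [MeasurableSpace Ω] {Pr : Measure Ω}
  {ν : Measure M} [SigmaFinite ν] {X : Ω → Config M}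

theorem measurePreserving_eval_zero {α : Type*} [MeasurableSpace α] (μ : Measure α)
    [SigmaFinite μ] :
    MeasurePreserving (fun z : Fin 1 → α => z 0) (Measure.pi fun _ => μ) μ :=
  measurePreserving_funUnique μ (Fin 1)

theorem lintegral_sum_points [MeasurableEq M] (hX : Measurable X)
    (hρ : AreIntensityFunctions Pr X ν ρ) {g : S2 × M → ℝ≥0∞} (hg : Measurable g) :
    ∫⁻ ω, ∑ z ∈ (X ω).points, g z ∂Pr = ∫⁻ z, intensity ρ z * g z ∂(area.prod ν) := by
  have h1 : ∀ c : Config M, ∑ z ∈ c.points, g z = ∑ z ∈ c.distinctTuples 1, ∏ i, g (z i) := by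
    intro c
    rw [Config.sum_distinctTuples_prod, elemSymm, Finset.powersetCard_one, Finset.sum_map]
    simp
  simp only [h1]
  have hgm : Measurable fun z : Fin 1 → S2 × M => ∏ i, g (z i) :=
    Finset.measurable_prod _ fun i _ => hg.comp (measurable_pi_apply i)
  have h3 := (measurePreserving_eval_zero (area.prod ν)).lintegral_comp
    (f := fun z => intensity ρ z * g z) (hρ.measurable_intensity.coe_nnreal_ennreal.mul hg)
  rw [lintegral_sum_distinctTuples hX hρ le_rfl hgm, ← h3]
  refine lintegral_congr fun z => ?_
  have h : z = fun _ => z 0 := funext fun i => by rw [Subsingleton.elim i 0]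
  have h2 : ρ 1 z = intensity ρ (z 0) := congrArg (ρ 1) h
  rw [h2]
  simp

theorem intensityMeasure_eq_withDensity [MeasurableEq M] (hX : Measurable X)
    (hρ : AreIntensityFunctions Pr X ν ρ) :
    intensityMeasure Pr X = (area.prod ν).withDensity fun z => (intensity ρ z : ℝ≥0∞) := by
  classical
  ext A hA
  rw [intensityMeasure_apply hX hA, withDensity_apply _ hA, ← lintegral_indicator hA]
  have h := lintegral_sum_points hX hρ (g := A.indicator 1) (measurable_one.indicator hA)
  have h1 : ∀ c : Config M, ∑ z ∈ c.points, A.indicator (1 : S2 × M → ℝ≥0∞) z = c.count A := by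
    intro c
    simp [Config.count, Set.indicator_apply]
  simp only [h1] at h
  rw [h]
  refine lintegral_congr fun z => ?_
  by_cases hz : z ∈ A <;> simp [hz]

/-- Erasing a `C`-point leaves the `E`-part unchanged. The reduced Campbell measure of `A` and an
event about the `E`-part is thus the expectation of a count in `A` times an indicator, which
independence factorizes. -/
theorem ae_palm_restrictMarks [MeasurableEq M] [MeasurableSpace.CountablyGenerated M]
    [IsProbabilityMeasure Pr] (hX : Measurable X)
    (hρ : AreIntensityFunctions Pr X ν ρ) (hpos : ∀ z, 0 < intensity ρ z)
    {P : Kernel (S2 × M) (Config M)} (hP : IsReducedPalm Pr X P)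
    {C E : Set M} (hC : MeasurableSet C) (hE : MeasurableSet E) (hCE : Disjoint C E)
    (hind : IndepFun (fun ω => (X ω).restrictMarks C) (fun ω => (X ω).restrictMarks E) Pr) :
    ∀ᵐ z ∂(area.prod ν), z.2 ∈ C →
      (P z).map (fun c => c.restrictMarks E) = (Pr.map X).map fun c => c.restrictMarks E := by
  classical
  have := hP.1
  have hrE := Config.measurable_restrictMarks (M := M) hE
  have hrC := Config.measurable_restrictMarks (M := M) hC
  set μ := intensityMeasure Pr X with hμ
  have hμd : μ = (area.prod ν).withDensity fun z => (intensity ρ z : ℝ≥0∞) :=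
    intensityMeasure_eq_withDensity hX hρ
  have : SigmaFinite μ := by rw [hμd]; infer_instance
  have hSC : MeasurableSet (Prod.snd ⁻¹' C : Set (S2 × M)) := measurable_snd hC
  have hprob : IsProbabilityMeasure (Pr.map X) := Measure.isProbabilityMeasure_map hX.aemeasurable
  have key : ∀ N : Set (Config M), MeasurableSet N → ∀ A, MeasurableSet A →
      A ⊆ Prod.snd ⁻¹' C →
      ∫⁻ z in A, P z ((fun c => c.restrictMarks E) ⁻¹' N) ∂μ =
        ∫⁻ _ in A, (Pr.map X) ((fun c => c.restrictMarks E) ⁻¹' N) ∂μ := by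
    intro N hN A hA hAC
    rw [← hP.2 A _ hA (hrE hN), reducedCampbell, lintegral_const, Measure.restrict_apply_univ,
      hμ, intensityMeasure_apply hX hA, Measure.map_apply hX (hrE hN)]
    have h1 : ∀ ω, ∑ z ∈ (X ω).points,
        (A ×ˢ ((fun c : Config M => c.restrictMarks E) ⁻¹' N)).indicator (1 : (S2 × M) × Config M → ℝ≥0∞)
          (z, (X ω).erase z) =
        (fun c : Config M => (c.count A : ℝ≥0∞)) ((X ω).restrictMarks C) *
          N.indicator (1 : Config M → ℝ≥0∞) ((X ω).restrictMarks E) := by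
      intro ω
      have hcount : ((X ω).restrictMarks C).count A = (X ω).count A := by
        rw [Config.count_restrictMarks, Set.inter_eq_self_of_subset_left hAC]
      dsimp only
      rw [hcount, Config.count, Finset.card_filter]
      push_cast
      rw [Finset.sum_mul]
      refine Finset.sum_congr rfl fun z _ => ?_
      by_cases hz : z ∈ A
      · have hzE : z.2 ∉ E := Set.disjoint_left.1 hCE (hAC hz)
        simp [Set.indicator_apply, hz, Config.erase_restrictMarks _ hzE]
      · simp [hz]
    have h2 : ∀ ω, ((fun c : Config M => (c.count A : ℝ≥0∞)) ((X ω).restrictMarks C)) =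
        ((X ω).count A : ℝ≥0∞) := by
      intro ω
      dsimp only
      rw [Config.count_restrictMarks, Set.inter_eq_self_of_subset_left hAC]
    have hm1 := Config.measurable_count_ennreal (M := M) hA
    have hm2 : Measurable (N.indicator (1 : Config M → ℝ≥0∞)) := measurable_one.indicator hN
    have h3 := lintegral_mul_eq_lintegral_mul_lintegral_of_indepFun
      (hm1.comp (hrC.comp hX)) (hm2.comp (hrE.comp hX)) (hind.comp hm1 hm2)
    simp only [h1]
    refine h3.trans ?_
    simp only [Function.comp_def] at h2 ⊢
    simp only [h2]
    rw [mul_comm]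
    congr 1
    rw [← lintegral_indicator_one (hX (hrE hN))]
    rfl
  obtain ⟨S, hS, hpi, hgen, huniv⟩ := exists_countable_isPiSystem (Config M)
  have hSm : ∀ N ∈ S, MeasurableSet N := fun N hN => by
    rw [hgen]; exact MeasurableSpace.measurableSet_generateFrom hN
  -- The exceptional null set depends on the event `N`. Restricting to a countable π-system gives
  -- one null set, and agreement on the π-system determines the measures.
  have hae : ∀ᵐ z ∂μ.restrict (Prod.snd ⁻¹' C), ∀ N ∈ S,
      P z ((fun c => c.restrictMarks E) ⁻¹' N) =
        (Pr.map X) ((fun c => c.restrictMarks E) ⁻¹' N) := by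
    rw [ae_ball_iff hS]
    intro N hN
    refine ae_eq_of_forall_setLIntegral_eq_of_sigmaFinite
      (P.measurable_coe (hrE (hSm N hN))) measurable_const fun A hA _ => ?_
    rw [Measure.restrict_restrict hA]
    exact key N (hSm N hN) _ (hA.inter hSC) Set.inter_subset_right
  have hae2 : ∀ᵐ z ∂μ, z.2 ∈ C →
      (P z).map (fun c => c.restrictMarks E) = (Pr.map X).map fun c => c.restrictMarks E := by
    refine (ae_restrict_iff' hSC).1 ?_
    filter_upwards [hae] with z hz
    refine ext_of_generate_finite S hgen hpi (fun N hN => ?_) ?_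
    · rw [Measure.map_apply hrE (hSm N hN), Measure.map_apply hrE (hSm N hN), hz N hN]
    · rw [Measure.map_apply hrE MeasurableSet.univ, Measure.map_apply hrE MeasurableSet.univ]
      simp
  rw [hμd, ae_withDensity_iff hρ.measurable_intensity.coe_nnreal_ennreal] at hae2
  filter_upwards [hae2] with z hz
  -- Positivity of the intensity turns a null set of the intensity measure into a null set of the
  -- reference measure.
  exact hz (by simpa using (hpos z).ne')

theorem measurePreserving_cons {α : Type*} [MeasurableSpace α] (μ : Measure α) [SigmaFinite μ]
    (n : ℕ) : MeasurePreserving (fun p : α × (Fin n → α) => (Fin.cons p.1 p.2 : Fin (n + 1) → α))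
      (μ.prod (Measure.pi fun _ => μ)) (Measure.pi fun _ => μ) := by
  have h := (measurePreserving_piFinSuccAbove (fun _ : Fin (n + 1) => μ) 0).symm
  convert h using 1
  funext p i
  induction i using Fin.cases with
  | zero => rfl
  | succ i => rfl

theorem measurePreserving_cons_refMeasure (ν : Measure M) [SigmaFinite ν] (n : ℕ) :
    MeasurePreserving
      (fun p : (S2 × M) × (Fin n → S2 × M) => (Fin.cons p.1 p.2 : Fin (n + 1) → S2 × M))
      ((area.prod ν).prod (refMeasurePow ν n)) (refMeasurePow ν (n + 1)) :=
  measurePreserving_cons _ n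

end Independence

/-! ### Factorization of the intensities and vanishing of the mixed correlations. -/

section Factorization

/-- Dropping coordinates need not preserve the measure, since the dropped factors need not have mass
one. It does pull null sets back to null sets, which is enough to apply almost-everywhere identities
to subtuples. -/
theorem quasiMeasurePreserving_comp_injective {α : Type*} [MeasurableSpace α] (μ : Measure α)
    [SigmaFinite μ] {k n : ℕ} {e : Fin k → Fin n} (he : Function.Injective e) :
    Measure.QuasiMeasurePreserving (fun (z : Fin n → α) i => z (e i))
      (Measure.pi fun _ => μ) (Measure.pi fun _ => μ) := by
  classical
  let _ : Fintype (Set.range e) := Subtype.fintype _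
  have h1 := (measurePreserving_piEquivPiSubtypeProd (fun _ : Fin n => μ)
    (· ∈ Set.range e)).quasiMeasurePreserving
  have h2 := (measurePreserving_piCongrLeft (fun _ : Set.range e => μ)
    (Equiv.ofInjective e he)).symm.quasiMeasurePreserving
  exact h2.comp (Measure.quasiMeasurePreserving_fst.comp h1)

theorem quasiMeasurePreserving_id_prod {α β γ : Type*} [MeasurableSpace α] [MeasurableSpace β]
    [MeasurableSpace γ] (μ : Measure α) [SFinite μ] {μ₁ : Measure β} [SFinite μ₁]
    {μ₂ : Measure γ} [SFinite μ₂] {f : β → γ} (hf : Measure.QuasiMeasurePreserving f μ₁ μ₂) :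
    Measure.QuasiMeasurePreserving (fun p : α × β => (p.1, f p.2)) (μ.prod μ₁) (μ.prod μ₂) := by
  refine ⟨measurable_fst.prodMk (hf.measurable.comp measurable_snd), ?_⟩
  have h := Measure.map_prod_map μ μ₁ measurable_id hf.measurable
  rw [Measure.map_id] at h
  exact h.symm.absolutelyContinuous.trans (Measure.AbsolutelyContinuous.rfl.prod
    hf.absolutelyContinuous)

theorem Rotation.actMarked_cons {M : Type*} (O : Rotation) {n : ℕ} (z₀ : S2 × M)
    (z : Fin n → S2 × M) :
    (fun i => O.actMarked ((Fin.cons z₀ z : Fin (n + 1) → S2 × M) i)) =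
      Fin.cons (O.actMarked z₀) fun i => O.actMarked (z i) := by
  funext i
  induction i using Fin.cases with
  | zero => rfl
  | succ i => rfl

variable {M : Type*} [MeasurableSpace M] {ρ : (n : ℕ) → (Fin n → S2 × M) → ℝ≥0}
  {Ω : Type*} [MeasurableSpace Ω] {Pr : Measure Ω}
  {ν : Measure M} [SigmaFinite ν] {X : Ω → Config M}

theorem quasiMeasurePreserving_refMeasure (ν : Measure M) [SigmaFinite ν] {k n : ℕ}
    {e : Fin k → Fin n} (he : Function.Injective e) :
    Measure.QuasiMeasurePreserving (fun p : (S2 × M) × (Fin n → S2 × M) => (p.1, fun i => p.2 (e i)))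
      ((area.prod ν).prod (refMeasurePow ν n)) ((area.prod ν).prod (refMeasurePow ν k)) :=
  quasiMeasurePreserving_id_prod _ (quasiMeasurePreserving_comp_injective (area.prod ν) he)

/-- By Campbell's formula the left side is the expectation of a sum over `C`-points times a sum over
tuples of `E`-points, and independence splits it. -/
theorem lintegral_intensity_succ [MeasurableEq M] (hX : Measurable X)
    (hρ : AreIntensityFunctions Pr X ν ρ) {C E : Set M} (hC : MeasurableSet C)
    (hE : MeasurableSet E) (hCE : Disjoint C E)
    (hind : IndepFun (fun ω => (X ω).restrictMarks C) (fun ω => (X ω).restrictMarks E) Pr)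
    {n : ℕ} (hn : 1 ≤ n) {g : S2 × M → ℝ≥0∞} (hg : Measurable g) (hgC : ∀ z, z.2 ∉ C → g z = 0)
    {h : (Fin n → S2 × M) → ℝ≥0∞} (hh : Measurable h) (hhE : ∀ z i, (z i).2 ∉ E → h z = 0) :
    ∫⁻ p, ρ (n + 1) (Fin.cons p.1 p.2) * (g p.1 * h p.2)
        ∂((area.prod ν).prod (refMeasurePow ν n)) =
      (∫⁻ z, intensity ρ z * g z ∂(area.prod ν)) *
        ∫⁻ z, ρ n z * h z ∂(refMeasurePow ν n) := by
  have htail : Measurable fun w : Fin (n + 1) → S2 × M => Fin.tail w :=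
    measurable_pi_lambda _ fun i => measurable_pi_apply i.succ
  have hgh : Measurable fun w : Fin (n + 1) → S2 × M => g (w 0) * h (Fin.tail w) :=
    (hg.comp (measurable_pi_apply 0)).mul (hh.comp htail)
  have h1 := (measurePreserving_cons_refMeasure ν n).lintegral_comp
    (f := fun w => ρ (n + 1) w * (g (w 0) * h (Fin.tail w)))
    ((hρ (n + 1) (by omega)).1.coe_nnreal_ennreal.mul hgh)
  simp only [Fin.cons_zero, Fin.tail_cons] at h1
  rw [h1, ← lintegral_sum_distinctTuples hX hρ (by omega) hgh, ← lintegral_sum_points hX hρ hg,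
    ← lintegral_sum_distinctTuples hX hρ hn hh]
  simp only [Config.sum_distinctTuples_succ _ hCE hgC hhE]
  have hm1 := Config.measurable_sum_points hg
  have hm2 := Config.measurable_sum_distinctTuples hh
  have h3 := lintegral_mul_eq_lintegral_mul_lintegral_of_indepFun
    (hm1.comp ((Config.measurable_restrictMarks hC).comp hX))
    (hm2.comp ((Config.measurable_restrictMarks hE).comp hX)) (hind.comp hm1 hm2)
  simpa only [Function.comp_def, Pi.mul_apply, Config.sum_points_restrictMarks _ hgC,
    Config.sum_distinctTuples_restrictMarks _ hhE] using h3

/-- If the points with marks in `C` are independent of those with marks in `E`, the intensity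
functions factorize almost everywhere. -/
theorem ae_intensity_succ [MeasurableEq M] (hX : Measurable X)
    (hρ : AreIntensityFunctions Pr X ν ρ) {C E : Set M} (hC : MeasurableSet C)
    (hE : MeasurableSet E) (hCE : Disjoint C E)
    (hind : IndepFun (fun ω => (X ω).restrictMarks C) (fun ω => (X ω).restrictMarks E) Pr)
    {n : ℕ} (hn : 1 ≤ n) :
    ∀ᵐ p ∂((area.prod ν).prod (refMeasurePow ν n)), p.1.2 ∈ C → (∀ i, (p.2 i).2 ∈ E) →
      ρ (n + 1) (Fin.cons p.1 p.2) = intensity ρ p.1 * ρ n p.2 := by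
  set m₁ := area.prod ν
  set mₙ := refMeasurePow ν n
  set SC : Set (S2 × M) := Prod.snd ⁻¹' C
  set SE : Set (Fin n → S2 × M) := Set.univ.pi fun _ => Prod.snd ⁻¹' E
  have hSC : MeasurableSet SC := measurable_snd hC
  have hSE : MeasurableSet SE := MeasurableSet.univ_pi fun _ => measurable_snd hE
  have hf : Measurable fun p : (S2 × M) × (Fin n → S2 × M) =>
      (ρ (n + 1) (Fin.cons p.1 p.2) : ℝ≥0∞) :=
    ((hρ (n + 1) (by omega)).1.comp
      (measurePreserving_cons_refMeasure ν n).measurable).coe_nnreal_ennreal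
  have hi := hρ.measurable_intensity.coe_nnreal_ennreal
  have hρn := (hρ n hn).1.coe_nnreal_ennreal
  have hfac : Measurable fun p : (S2 × M) × (Fin n → S2 × M) =>
      (intensity ρ p.1 : ℝ≥0∞) * (ρ n p.2 : ℝ≥0∞) :=
    (hi.comp measurable_fst).mul (hρn.comp measurable_snd)
  -- Two measures that agree on rectangles coincide; comparing their densities gives the pointwise
  -- identity almost everywhere.
  have heq : ((m₁.withDensity fun z => (intensity ρ z : ℝ≥0∞)).restrict SC).prod
      ((mₙ.withDensity fun z => (ρ n z : ℝ≥0∞)).restrict SE) =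
      ((m₁.prod mₙ).withDensity fun p => (ρ (n + 1) (Fin.cons p.1 p.2) : ℝ≥0∞)).restrict
        (SC ×ˢ SE) := by
    refine Measure.prod_eq fun A B hA hB => ?_
    have h := lintegral_intensity_succ hX hρ hC hE hCE hind hn
      (g := (A ∩ SC).indicator 1) (measurable_one.indicator (hA.inter hSC))
      (fun z hz => Set.indicator_of_notMem (fun h => hz h.2) _)
      (h := (B ∩ SE).indicator 1) (measurable_one.indicator (hB.inter hSE))
      (fun z i hz => Set.indicator_of_notMem (fun h => hz (h.2 i (Set.mem_univ i))) _)
    have hind1 : ∀ {β : Type _} (s : Set β) (f : β → ℝ≥0∞),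
        (fun x => f x * s.indicator 1 x) = s.indicator f := fun s f => by
      funext x; by_cases hx : x ∈ s <;> simp [hx]
    have hprod : (fun p : (S2 × M) × (Fin n → S2 × M) => (ρ (n + 1) (Fin.cons p.1 p.2) : ℝ≥0∞) *
        ((A ∩ SC).indicator 1 p.1 * (B ∩ SE).indicator 1 p.2)) =
        ((A ∩ SC) ×ˢ (B ∩ SE)).indicator fun p => (ρ (n + 1) (Fin.cons p.1 p.2) : ℝ≥0∞) := by
      funext p
      by_cases h1 : p.1 ∈ A ∩ SC
      · by_cases h2 : p.2 ∈ B ∩ SE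
        · simp only [Set.indicator_of_mem h1, Set.indicator_of_mem h2,
            Set.indicator_of_mem (Set.mk_mem_prod h1 h2), Pi.one_apply, mul_one]
        · rw [Set.indicator_of_notMem h2, Set.indicator_of_notMem (s := (A ∩ SC) ×ˢ (B ∩ SE)) fun h => h2 h.2, mul_zero,
            mul_zero]
      · rw [Set.indicator_of_notMem h1, Set.indicator_of_notMem (s := (A ∩ SC) ×ˢ (B ∩ SE)) fun h => h1 h.1, zero_mul,
            mul_zero]
    rw [hprod, hind1, hind1, lintegral_indicator ((hA.inter hSC).prod (hB.inter hSE)),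
      lintegral_indicator (hA.inter hSC), lintegral_indicator (hB.inter hSE)] at h
    rw [Measure.restrict_apply (hA.prod hB), Set.prod_inter_prod,
      withDensity_apply _ ((hA.inter hSC).prod (hB.inter hSE)), Measure.restrict_apply hA,
      Measure.restrict_apply hB, withDensity_apply _ (hA.inter hSC),
      withDensity_apply _ (hB.inter hSE)]
    exact h
  rw [Measure.prod_restrict, prod_withDensity hi hρn,
    restrict_withDensity (hSC.prod hSE), restrict_withDensity (hSC.prod hSE),
    withDensity_eq_iff_of_sigmaFinite hfac.aemeasurable hf.aemeasurable] at heq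
  filter_upwards [(ae_restrict_iff' (hSC.prod hSE)).1 heq] with p hp h1 h2
  have := hp ⟨h1, fun i _ => h2 i⟩
  exact_mod_cast this.symm

theorem ae_reweighted_succ [MeasurableEq M] (hX : Measurable X)
    (hρ : AreIntensityFunctions Pr X ν ρ) (hpos : ∀ z, 0 < intensity ρ z)
    {C E : Set M} (hC : MeasurableSet C) (hE : MeasurableSet E) (hCE : Disjoint C E)
    (hind : IndepFun (fun ω => (X ω).restrictMarks C) (fun ω => (X ω).restrictMarks E) Pr)
    {n : ℕ} (hn : 1 ≤ n) :
    ∀ᵐ p ∂((area.prod ν).prod (refMeasurePow ν n)), p.1.2 ∈ C → (∀ i, (p.2 i).2 ∈ E) →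
      reweighted ρ (n + 1) (Fin.cons p.1 p.2) = reweighted ρ n p.2 := by
  filter_upwards [ae_intensity_succ hX hρ hC hE hCE hind hn] with p hp h1 h2
  rw [reweighted, hp h1 h2, Fin.prod_univ_succ, Fin.cons_zero, reweighted]
  simp only [Fin.cons_succ]
  exact mul_div_mul_left _ _ (hpos _).ne'

/-- The combinatorial lemma needs the factorization for all subtuples simultaneously. There are only
countably many index choices, and each contributes a null set. -/
theorem ae_correlation_eq_zero [MeasurableEq M] (hX : Measurable X)
    (hρ : AreIntensityFunctions Pr X ν ρ) (hpos : ∀ z, 0 < intensity ρ z)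
    {C E : Set M} (hC : MeasurableSet C) (hE : MeasurableSet E) (hCE : Disjoint C E)
    (hind : IndepFun (fun ω => (X ω).restrictMarks C) (fun ω => (X ω).restrictMarks E) Pr)
    {n : ℕ} (hn : 1 ≤ n) :
    ∀ᵐ p ∂((area.prod ν).prod (refMeasurePow ν n)), p.1.2 ∈ C → (∀ i, (p.2 i).2 ∈ E) →
      correlation ρ (n + 1) (Fin.cons p.1 p.2) = 0 := by
  have hall : ∀ᵐ p ∂((area.prod ν).prod (refMeasurePow ν n)), ∀ k, 1 ≤ k →
      ∀ e : Fin k ↪o Fin n, p.1.2 ∈ C → (∀ i, (p.2 (e i)).2 ∈ E) →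
        reweighted ρ (k + 1) (Fin.cons p.1 fun i => p.2 (e i)) =
          reweighted ρ k fun i => p.2 (e i) := by
    refine ae_all_iff.2 fun k => ?_
    by_cases hk : 1 ≤ k
    · have : Finite (Fin k ↪o Fin n) := DFunLike.finite _
      have h : ∀ᵐ p ∂((area.prod ν).prod (refMeasurePow ν n)),
          ∀ e : Fin k ↪o Fin n, p.1.2 ∈ C → (∀ i, (p.2 (e i)).2 ∈ E) →
            reweighted ρ (k + 1) (Fin.cons p.1 fun i => p.2 (e i)) =
              reweighted ρ k fun i => p.2 (e i) :=
        ae_all_iff.2 fun e => (quasiMeasurePreserving_refMeasure ν e.injective).ae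
          (ae_reweighted_succ hX hρ hpos hC hE hCE hind hk)
      filter_upwards [h] with p hp _ using hp
    · exact ae_of_all _ fun p h => (hk h).elim
  filter_upwards [hall] with p hp h1 h2
  refine correlation_eq_zero hpos n hn _ fun k hk e => ?_
  simpa using hp k hk e h1 fun i => h2 (e i)

/-- This upgrades almost every location to every location. Fubini and `area ≠ 0` supply one good
`y₀`, and isotropy transfers the vanishing from there. -/
theorem ae_JIntegrand_eq_zero [MeasurableEq M] (hX : Measurable X)
    (hρ : AreIntensityFunctions Pr X ν ρ) (hiso : IsIRWMI ρ)
    {C E : Set M} (hC : MeasurableSet C) (hE : MeasurableSet E) (hCE : Disjoint C E)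
    (hind : IndepFun (fun ω => (X ω).restrictMarks C) (fun ω => (X ω).restrictMarks E) Pr)
    {n : ℕ} (hn : 1 ≤ n) (y : S2) (O : Rotation) (hO : O.act northPole = y) :
    ∀ᵐ q ∂(ν.prod (refMeasurePow ν n)), q.1 ∈ C → (∀ i, (q.2 i).2 ∈ E) →
      JIntegrand ρ n y O q.1 q.2 = 0 := by
  have h1 := ((measurePreserving_prodAssoc area ν (refMeasurePow ν n)).symm).quasiMeasurePreserving.ae
    (ae_correlation_eq_zero hX hρ hiso.intensity_pos hC hE hCE hind hn)
  have h2 := Measure.ae_ae_of_ae_prod h1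
  have : NeBot (ae area) := ae_neBot.2 area_ne_zero
  obtain ⟨y₀, hy₀⟩ := h2.exists
  obtain ⟨O₀, hO₀⟩ := exists_rotation northPole y₀
  have hmp := ((MeasurePreserving.id ν).prod (O₀.measurePreserving_tuple ν n)).quasiMeasurePreserving
  filter_upwards [hmp.ae hy₀] with q hq hqC hqE
  have hq' : correlation ρ (n + 1)
      (Fin.cons (y₀, q.1) fun i => O₀.actMarked (q.2 i)) = 0 := hq hqC hqE
  -- In rotated coordinates the integrand equals its value at the north pole, so it depends neither
  -- on `y` nor on the choice of `O`.
  have hrot : ∀ (O : Rotation) (y : S2), O.act northPole = y →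
      correlation ρ (n + 1) (Fin.cons (y, q.1) fun i => O.actMarked (q.2 i)) =
        correlation ρ (n + 1) (Fin.cons (northPole, q.1) q.2) := by
    rintro O y rfl
    have h := hiso.2 (n + 1) (by omega) (Fin.cons (northPole, q.1) q.2) O
    rw [Rotation.actMarked_cons] at h
    exact h.symm
  rw [JIntegrand, hrot O y hO, ← hrot O₀ y₀ hO₀, hq']

theorem JIntegrand_ae_eq_zero_restrict [MeasurableEq M] (hX : Measurable X)
    (hρ : AreIntensityFunctions Pr X ν ρ) (hiso : IsIRWMI ρ)
    {C E : Set M} (hC : MeasurableSet C) (hE : MeasurableSet E) (hCE : Disjoint C E)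
    (hind : IndepFun (fun ω => (X ω).restrictMarks C) (fun ω => (X ω).restrictMarks E) Pr)
    {n : ℕ} (hn : 1 ≤ n) (y : S2) (O : Rotation) (hO : O.act northPole = y) (r : ℝ) :
    (fun q : M × (Fin n → S2 × M) => JIntegrand ρ n y O q.1 q.2)
      =ᵐ[(ν.restrict C).prod ((refMeasurePow ν n).restrict (capTuples E r n))] 0 := by
  have hcap : MeasurableSet (capTuples E r n) :=
    MeasurableSet.univ_pi fun _ => (measurableSet_geoBall northPole r).prod hE
  rw [Measure.prod_restrict]
  refine (ae_restrict_iff' (hC.prod hcap)).2 ?_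
  filter_upwards [ae_JIntegrand_eq_zero hX hρ hiso hC hE hCE hind hn y O hO] with q hq hqm
  exact hq hqm.1 fun i => (hqm.2 i (Set.mem_univ i)).2

theorem Jn_eq_zero [MeasurableEq M] (hX : Measurable X)
    (hρ : AreIntensityFunctions Pr X ν ρ) (hiso : IsIRWMI ρ)
    {C E : Set M} (hC : MeasurableSet C) (hE : MeasurableSet E) (hCE : Disjoint C E)
    (hind : IndepFun (fun ω => (X ω).restrictMarks C) (fun ω => (X ω).restrictMarks E) Pr)
    {n : ℕ} (hn : 1 ≤ n) (y : S2) (O : Rotation) (hO : O.act northPole = y) (r : ℝ) :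
    Jn ν ρ C E n y O r = 0 := by
  have h := Measure.ae_ae_of_ae_prod
    (JIntegrand_ae_eq_zero_restrict hX hρ hiso hC hE hCE hind hn y O hO r)
  refine integral_eq_zero_of_ae ?_
  filter_upwards [h] with m hm
  exact integral_eq_zero_of_ae hm

/-- Points with marks outside `E` contribute the factor one, so the generating functional sees only
the law of the `E`-part. -/
theorem genFun_palm_eq (hρ : AreIntensityFunctions Pr X ν ρ) {E : Set M} (hE : MeasurableSet E)
    {Q : Measure (Config M)}
    (hQ : Q.map (fun c => c.restrictMarks E) = (Pr.map X).map fun c => c.restrictMarks E)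
    (y : S2) (r : ℝ) :
    genFun Q (fun z => 1 - uFun ρ E y r z) =
      genFun (Pr.map X) (fun z => 1 - uFun ρ E y r z) := by
  have hrE := Config.measurable_restrictMarks (M := M) hE
  have key : ∀ Q : Measure (Config M), genFun Q (fun z => 1 - uFun ρ E y r z) =
      genFun (Q.map fun c => c.restrictMarks E) (fun z => 1 - uFun ρ E y r z) := by
    intro Q
    rw [genFun, genFun, integral_map hrE.aemeasurable
      (hρ.measurable_prod_one_sub hE y r).aestronglyMeasurable]
    refine integral_congr_ae (ae_of_all _ fun c => ?_)
    exact (Config.prod_points_restrictMarks c fun z hz => by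
      rw [uFun_eq_zero y r hz, sub_zero]).symm
  rw [key Q, hQ, ← key]

end Factorization

end SphereMPP

theorem mainTheorem2 {Ω M : Type*} [MeasurableSpace Ω] [TopologicalSpace M] [PolishSpace M]
    [MeasurableSpace M] [BorelSpace M]
    (Pr : Measure Ω) [IsProbabilityMeasure Pr] (ν : Measure M) [SigmaFinite ν]
    (X : Ω → Config M) (hX : IsMarkedPointProcess Pr X)
    (ρ : (n : ℕ) → (Fin n → S2 × M) → ℝ≥0) (hρ : AreIntensityFunctions Pr X ν ρ)
    (hiso : IsIRWMI ρ)
    (P : Kernel (S2 × M) (Config M)) (hP : IsReducedPalm Pr X P)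
    (C E : Set M) (hC : MeasurableSet C) (hE : MeasurableSet E) (hCE : Disjoint C E)
    (hνC : 0 < ν C) (hνC' : ν C < ∞) (hνE : 0 < ν E)
    (hind : IndepFun (fun ω => (X ω).restrictMarks C) (fun ω => (X ω).restrictMarks E) Pr)
    (R : ℝ) (hR : R ∈ Set.Icc 0 Real.pi) (hmom : MomentCondition ν ρ E R) :
    (∀ᵐ y ∂area, ∀ y' : S2, ∀ r ∈ Set.Icc 0 R,
      DInhom P ν ρ C E y r = FInhom Pr X ρ E y' r) ∧
    (∀ (y : S2) (O : Rotation), O.act northPole = y → ∀ r ∈ Set.Icc 0 R,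
      JInhomConverges ν ρ C E y O r ∧ JInhom ν ρ C E y O r = 1) := by
  have hreal : ν.real C ≠ 0 := (ENNReal.toReal_pos hνC.ne' hνC'.ne).ne'
  constructor
  -- By Fubini the exceptional set of `y` is fixed before `y'` and `r` are chosen, so it serves all
  -- of them.
  · filter_upwards [Measure.ae_ae_of_ae_prod (ae_palm_restrictMarks hX.measurable hρ
      hiso.intensity_pos hP hC hE hCE hind)] with y hy y' r hr
    have hint : ∫ m in C, genFun (P (y, m)) (fun z => 1 - uFun ρ E y r z) ∂ν =
        ∫ _ in C, genFun (Pr.map X) (fun z => 1 - uFun ρ E y r z) ∂ν := by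
      refine integral_congr_ae ((ae_restrict_iff' hC).2 ?_)
      filter_upwards [hy] with m hm hmC
      exact genFun_palm_eq hρ hE (hm hmC) y r
    -- Averaging a constant over `C` gives the ordinary functional at `y`; its expansion and the one
    -- at `y'` are the same series.
    rw [DInhom, FInhom, hint, setIntegral_const, smul_eq_mul, inv_mul_cancel_left₀ hreal,
      genFun_uFun_eq_tsum hX.measurable hρ hiso hE hmom y hr.2,
      genFun_uFun_eq_tsum hX.measurable hρ hiso hE hmom y' hr.2]
  · intro y O hO r _
    have hterm : ∀ n, JTerm ν ρ C E y O r (n + 1) = 0 := fun n => by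
      rw [JTerm, Jn_eq_zero hX.measurable hρ hiso hC hE hCE hind (by omega) y O hO r, mul_zero]
    refine ⟨⟨fun n hn => ?_, ?_⟩, ?_⟩
    · exact (integrable_zero _ _ _).congr (JIntegrand_ae_eq_zero_restrict hX.measurable hρ hiso
        hC hE hCE hind hn y O hO r).symm
    · simp only [hterm]
      exact summable_zero
    · simp only [JInhom, hterm, tsum_zero, add_zero]
      exact inv_mul_cancel₀ hreal
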